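/- For a real number $p>0$ let $\Omega_p=\{(z_1,z_2)\in\mathbb{C}^2:\ |z_1|+|z_2|^{2/p}<1\}$, and let $K_p(z_1,z_2,w_1,w_2)$, for $(z_1,z_2),(w_1,w_2)\in\Omega_p$, be its Bergman kernel function: the reproducing kernel of the space of holomorphic functions on $\Omega_p$ that are square-integrable with respect to Lebesgue measure $V$. That is, for every $z\in\Omega_p$ the function $w\mapsto\overline{K_p(z,w)}$ belongs to this space, and $f(z)=\int_{\Omega_p}f(w)K_p(z,w)\,dV_w$ for every $f$ in it. Such a kernel exists for every $p>0$, and the following hold. 1. For $p>0$, there are points $(z_1,0),(w_1,0)\in\Omega_p$ with $K_p(z_1,0,w_1,0)=0$ if and only if $p>2$. 2. For $p>2$, there are points $(0,z_2),(0,w_2)\in\Omega_p$ with $K_p(0,z_2,0,w_2)=0$. 3. $K_2(z_1,z_2,w_1,w_2)\neq0$ for all $(z_1,z_2),(w_1,w_2)\in\Omega_2$. 4. $K_2$ vanishes at boundary points: $(1,0)$ and $(-1,0)$ are boundary points of $\Omega_2$, and $K_2(1,0,-1,0)=0$ in the sense of boundary values, i.e. $K_2(z,w)\to0$ as $(z,w)\to((1,0),(-1,0))$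 with $z,w\in\Omega_2$. -/

import Mathlib

open MeasureTheory Filter Topology

/-- Square-integrable holomorphic functions on `Ω ⊆ ℂ²` (with respect to Lebesgue measure). -/
def IsSquareIntegrableHolomorphic (Ω : Set (ℂ × ℂ)) (f : ℂ × ℂ → ℂ) : Prop :=
  DifferentiableOn ℂ f Ω ∧ MemLp f 2 (volume.restrict Ω)

/-- `K` is, on `Ω × Ω`, the Bergman kernel function of `Ω ⊆ ℂ²`: the reproducing kernel for the
space of square-integrable holomorphic functions on `Ω`. -/
structure IsBergmanKernel (Ω : Set (ℂ × ℂ)) (K : ℂ × ℂ → ℂ × ℂ → ℂ) : Prop where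
  conj_mem : ∀ z ∈ Ω, IsSquareIntegrableHolomorphic Ω (fun w => star (K z w))
  reproducing : ∀ f : ℂ × ℂ → ℂ, IsSquareIntegrableHolomorphic Ω f →
    ∀ z ∈ Ω, f z = ∫ w in Ω, f w * K z w

/-- The Bergman kernel is unique on `Ω × Ω`. -/
theorem IsBergmanKernel.unique {Ω : Set (ℂ × ℂ)} (hΩ : IsOpen Ω) {K L : ℂ × ℂ → ℂ × ℂ → ℂ}
    (hK : IsBergmanKernel Ω K) (hL : IsBergmanKernel Ω L) {z w : ℂ × ℂ} (hz : z ∈ Ω)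
    (hw : w ∈ Ω) : K z w = L z w := by
  set g : ℂ × ℂ → ℂ := fun u => star (K z u) - star (L z u) with hg
  have hgm : IsSquareIntegrableHolomorphic Ω g :=
    ⟨(hK.conj_mem z hz).1.sub (hL.conj_mem z hz).1, (hK.conj_mem z hz).2.sub (hL.conj_mem z hz).2⟩
  have h1 := hK.reproducing g hgm z hz
  have h2 := hL.reproducing g hgm z hz
  have mK : MemLp (K z) 2 (volume.restrict Ω) := by
    have h := (hK.conj_mem z hz).2.star
    have e : (star fun w => star (K z w)) = K z := by
      funext u
      exact star_star (K z u)
    rwa [e] at h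
  have mL : MemLp (L z) 2 (volume.restrict Ω) := by
    have h := (hL.conj_mem z hz).2.star
    have e : (star fun w => star (L z w)) = L z := by
      funext u
      exact star_star (L z u)
    rwa [e] at h
  have h3 : ∫ u in Ω, (g u * K z u - g u * L z u) = 0 := by
    have iK : Integrable (fun u => g u * K z u) (volume.restrict Ω) := hgm.2.integrable_mul mK
    have iL : Integrable (fun u => g u * L z u) (volume.restrict Ω) := hgm.2.integrable_mul mL
    rw [integral_sub iK iL, ← h1, ← h2, sub_self]
  have h4 : ∀ u, g u * K z u - g u * L z u = ((‖g u‖ ^ 2 : ℝ) : ℂ) := by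
    intro u
    have : K z u - L z u = star (g u) := by simp [hg]
    rw [← mul_sub, this]
    simpa using Complex.mul_conj' (g u)
  simp_rw [h4] at h3
  rw [integral_complex_ofReal, Complex.ofReal_eq_zero,
    integral_eq_zero_iff_of_nonneg (fun _ => by positivity) (hgm.2.integrable_norm_pow two_ne_zero)] at h3
  have h5 : g =ᵐ[volume.restrict Ω] (fun _ => 0) := by
    filter_upwards [h3] with u hu
    simpa using hu
  have h6 := Measure.eqOn_open_of_ae_eq h5 hΩ hgm.1.continuousOn continuousOn_const hw
  have h7 : star (K z w) = star (L z w) := sub_eq_zero.mp h6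
  exact star_injective h7

open Classical in
/-- The Bergman kernel function of `Ω ⊆ ℂ²` (the zero function if there is none). Only its values
on `Ω × Ω` are meaningful. -/
noncomputable def bergmanKernel (Ω : Set (ℂ × ℂ)) : ℂ × ℂ → ℂ × ℂ → ℂ :=
  if h : ∃ K, IsBergmanKernel Ω K then h.choose else 0

/-- The domain `|z₁| + |z₂|^(2/p) < 1` in `ℂ²`. -/
def OmegaDomain (p : ℝ) : Set (ℂ × ℂ) :=
  {z | ‖z.1‖ + ‖z.2‖ ^ (2 / p) < 1}

/-! On a bounded complete Reinhardt domain the monomials are orthogonal, and the Bergman kernel is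
the sum of z^k · conj(w^k) / ‖z^k‖² over bi-degrees k (`IsCompleteReinhardt.isBergmanKernel`). On
Ω_p the norms are Beta integrals (`monomNormSq_omegaDomain`), so the kernel is an explicit double
power series in ν = z₁w̄₁ and μ = z₂w̄₂ (`hasSum_bergmanKernel`), and every claim is about that
series.

For μ = 0 and ν = s², the series is, up to a constant factor and division by s, the odd part of (1 -
s)^(-(p+2)). A zero therefore means (1 + s)^(p+2) = (1 - s)^(p+2) with 0 < |s| < 1. Comparing moduli
gives s = iy, and comparing arguments gives (p + 2) arctan y ∈ πℤ. Since |arctan y| < π/4, a nonzero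
solution exists exactly when p > 2.

For ν = 0 the coefficients are cubic polynomials in the degree, so the kernel is rational in x = 1 -
μ. Its numerator, a quadratic in x, changes sign on (1, 2) when p > 2.

For p = 2, with ν = s² and μ = t², the coefficients are those of the part of 2/(1 - s - t)³ that is
odd in both s and t (`kernelCoeffTwo_eq`). Averaging over signs gives the rational function
`kernelTwo`. By Cauchy–Schwarz, points of Ω_2 yield |s| + |t| < 1. A zero of the numerator would
force an equality of moduli that the real inequality `mul_lt_nine_mul_of_bounds` excludes. The same
closed form is continuous at ν = -1, μ = 0 and vanishes there, which gives the boundary value. -/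

theorem HasSum.congr_terms {ι : Type*} {f g : ι → ℂ} {a : ℂ} (h : HasSum f a)
    (e : ∀ i, f i = g i) : HasSum g a :=
  (funext e : f = g) ▸ h

/-! ### One variable: Taylor series and averages over rotations. -/

/-- The `n`-th Taylor coefficient at `0`. -/
noncomputable def taylorCoeff (f : ℂ → ℂ) (n : ℕ) : ℂ :=
  (n.factorial : ℂ)⁻¹ * iteratedDeriv n f 0

/-- Open subsets of the plane containing with each point the closed disc about `0` through it. -/
structure IsCentredDisc (D : Set ℂ) : Prop where
  isOpen : IsOpen D
  mem_of_norm_le : ∀ w ∈ D, ∀ v : ℂ, ‖v‖ ≤ ‖w‖ → v ∈ D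

theorem IsCentredDisc.exists_ball {D : Set ℂ} (hD : IsCentredDisc D) {w : ℂ} (hw : w ∈ D) :
    ∃ R, ‖w‖ < R ∧ Metric.closedBall 0 R ⊆ D := by
  have h1 : ((‖w‖ : ℝ) : ℂ) ∈ D := hD.mem_of_norm_le w hw _ (by simp)
  obtain ⟨ε, hε, hb⟩ := Metric.isOpen_iff.1 hD.isOpen _ h1
  refine ⟨‖w‖ + ε / 2, by linarith, fun v hv => ?_⟩
  have h2 : ((‖w‖ + ε / 2 : ℝ) : ℂ) ∈ D := by
    apply hb
    rw [Metric.mem_ball, dist_eq_norm, ← Complex.ofReal_sub, Complex.norm_real, Real.norm_eq_abs,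
      abs_lt]
    constructor <;> linarith
  refine hD.mem_of_norm_le _ h2 _ ?_
  rw [Complex.norm_real, Real.norm_eq_abs, abs_of_nonneg (by positivity)]
  simpa using hv

theorem IsCentredDisc.hasSum_taylorCoeff {D : Set ℂ} (hD : IsCentredDisc D) {f : ℂ → ℂ}
    (hf : DifferentiableOn ℂ f D) {w : ℂ} (hw : w ∈ D) :
    HasSum (fun n => taylorCoeff f n * w ^ n) (f w) := by
  obtain ⟨R, hR, hb⟩ := hD.exists_ball hw
  have := Complex.hasSum_taylorSeries_on_ball
    (hf.mono (Metric.ball_subset_closedBall.trans hb)) (z := w) (by simpa using hR)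
  refine this.congr_terms fun n => ?_
  simp only [taylorCoeff, sub_zero, smul_eq_mul]
  ring

theorem integral_exp_pow_mul_exp_pow (k n : ℕ) :
    ∫ θ in (0 : ℝ)..2 * Real.pi,
      Complex.exp (θ * Complex.I) ^ k * Complex.exp (-(θ * Complex.I)) ^ n =
      if k = n then (2 * Real.pi : ℂ) else 0 := by
  have h : ∀ θ : ℝ, Complex.exp (θ * Complex.I) ^ k * Complex.exp (-(θ * Complex.I)) ^ n =
      Complex.exp (((k : ℂ) - n) * Complex.I * θ) := by
    intro θ
    rw [← Complex.exp_nat_mul, ← Complex.exp_nat_mul, ← Complex.exp_add]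
    congr 1
    ring
  simp_rw [h]
  split_ifs with hkn
  · simp [hkn]
  · have hc : ((k : ℂ) - n) * Complex.I ≠ 0 :=
      mul_ne_zero (sub_ne_zero.2 (by exact_mod_cast hkn)) Complex.I_ne_zero
    rw [integral_exp_mul_complex hc]
    have h1 : ((k : ℂ) - n) * Complex.I * ((2 * Real.pi : ℝ) : ℂ) =
        ((k - n : ℤ) : ℂ) * (2 * Real.pi * Complex.I) := by
      push_cast
      ring
    rw [h1, Complex.exp_int_mul_two_pi_mul_I]
    simp

/-- The Taylor series converges absolutely on the circle through `w`, so it can be integrated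
termwise, and only degree `n` survives. Keeping `w ^ n` on the right makes the identity valid at `w
= 0` too. -/
theorem IsCentredDisc.integral_rotate {D : Set ℂ} (hD : IsCentredDisc D) {f : ℂ → ℂ}
    (hf : DifferentiableOn ℂ f D) {w : ℂ} (hw : w ∈ D) (n : ℕ) :
    ∫ θ in (0 : ℝ)..2 * Real.pi,
      f (Complex.exp (θ * Complex.I) * w) * Complex.exp (-(θ * Complex.I)) ^ n =
      2 * Real.pi * (taylorCoeff f n * w ^ n) := by
  have hmem : ∀ θ : ℝ, Complex.exp (θ * Complex.I) * w ∈ D := fun θ =>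
    hD.mem_of_norm_le w hw _ (by simp [Complex.norm_exp_ofReal_mul_I])
  have hexp : ∀ θ : ℝ, ‖Complex.exp (-(θ * Complex.I))‖ = 1 := fun θ => by
    rw [Complex.norm_exp]; simp
  have hs : Summable fun k => ‖taylorCoeff f k * w ^ k‖ := (hD.hasSum_taylorCoeff hf hw).summable.norm
  have key := intervalIntegral.hasSum_integral_of_dominated_convergence (a := 0) (b := 2 * Real.pi)
    (μ := volume)
    (F := fun (k : ℕ) (θ : ℝ) => taylorCoeff f k * w ^ k *
      (Complex.exp (θ * Complex.I) ^ k * Complex.exp (-(θ * Complex.I)) ^ n))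
    (f := fun θ => f (Complex.exp (θ * Complex.I) * w) * Complex.exp (-(θ * Complex.I)) ^ n)
    (fun k _ => ‖taylorCoeff f k * w ^ k‖)
    (fun k => (by fun_prop : Continuous _).aestronglyMeasurable)
    (fun k => Eventually.of_forall fun θ _ => by
      rw [norm_mul _ (_ * _), norm_mul (_ ^ _), norm_pow (Complex.exp _), norm_pow (Complex.exp _),
        hexp, Complex.norm_exp_ofReal_mul_I]
      simp)
    (Eventually.of_forall fun _ _ => hs) (by simp)
    (Eventually.of_forall fun θ _ => by
      have := (hD.hasSum_taylorCoeff hf (hmem θ)).mul_right (Complex.exp (-(θ * Complex.I)) ^ n)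
      refine this.congr_terms fun k => ?_
      rw [mul_pow]
      ring)
  rw [← key.tsum_eq, tsum_eq_single n]
  · rw [intervalIntegral.integral_const_mul, integral_exp_pow_mul_exp_pow, if_pos rfl]
    ring
  · intro k hk
    rw [intervalIntegral.integral_const_mul, integral_exp_pow_mul_exp_pow, if_neg hk, mul_zero]

/-- Fubini on (angle) × X, together with invariance of the measure. Integrability of the average is
part of the conclusion because the average over the first coordinate is averaged again over the
second. -/
theorem integral_eq_average_of_measurePreserving {X : Type*} [MeasurableSpace X] {μ : Measure X}
    [SFinite μ] {T : ℝ → X → X} (hT : Measurable (Function.uncurry T))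
    (hTμ : ∀ θ, MeasurePreserving (T θ) μ μ) {F : X → ℂ} (hF : Integrable F μ) :
    Integrable (fun x => ∫ θ in (0 : ℝ)..2 * Real.pi, F (T θ x)) μ ∧
    2 * Real.pi * ∫ x, F x ∂μ = ∫ x, (∫ θ in (0 : ℝ)..2 * Real.pi, F (T θ x)) ∂μ := by
  have hpi : (0 : ℝ) ≤ 2 * Real.pi := by positivity
  set ν : Measure ℝ := volume.restrict (Set.Ioc 0 (2 * Real.pi)) with hν
  have hS : MeasurePreserving (fun q : ℝ × X => (q.1, T q.1 q.2)) (ν.prod μ) (ν.prod μ) :=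
    (MeasurePreserving.id ν).skew_product hT (Eventually.of_forall fun θ => (hTμ θ).map_eq)
  have hi : Integrable (fun q : ℝ × X => F (T q.1 q.2)) (ν.prod μ) :=
    hS.integrable_comp_of_integrable (hF.comp_snd ν)
  simp_rw [intervalIntegral.integral_of_le hpi, ← hν]
  refine ⟨hi.integral_prod_right, ?_⟩
  rw [← integral_prod_symm _ hi, integral_prod _ hi]
  have : ∀ θ, ∫ x, F (T θ x) ∂μ = ∫ x, F x ∂μ := by
    intro θ
    have h1 := integral_map (μ := μ) (hTμ θ).measurable.aemeasurable (f := F)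
      (by rw [(hTμ θ).map_eq]; exact hF.1)
    rw [(hTμ θ).map_eq] at h1
    exact h1.symm
  simp_rw [this]
  simp [hν, hpi]

/-! ### Reinhardt domains: double Taylor series and orthogonality. -/

/-- Bounded open complete Reinhardt domains in `ℂ²`. -/
structure IsCompleteReinhardt (Ω : Set (ℂ × ℂ)) : Prop where
  isOpen : IsOpen Ω
  isBounded : Bornology.IsBounded Ω
  mem_of_norm_le : ∀ z ∈ Ω, ∀ w : ℂ × ℂ, ‖w.1‖ ≤ ‖z.1‖ → ‖w.2‖ ≤ ‖z.2‖ → w ∈ Ω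

namespace IsCompleteReinhardt

variable {Ω : Set (ℂ × ℂ)} {f : ℂ × ℂ → ℂ}

theorem slice_fst (hΩ : IsCompleteReinhardt Ω) (b : ℂ) : IsCentredDisc {a | (a, b) ∈ Ω} where
  isOpen := hΩ.isOpen.preimage (by fun_prop : Continuous fun a : ℂ => (a, b))
  mem_of_norm_le w hw v hv := hΩ.mem_of_norm_le _ hw _ hv le_rfl

theorem slice_snd (hΩ : IsCompleteReinhardt Ω) (a : ℂ) : IsCentredDisc {b | (a, b) ∈ Ω} where
  isOpen := hΩ.isOpen.preimage (by fun_prop : Continuous fun b : ℂ => (a, b))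
  mem_of_norm_le w hw v hv := hΩ.mem_of_norm_le _ hw _ le_rfl hv

theorem differentiableOn_fst (_ : IsCompleteReinhardt Ω) (hf : DifferentiableOn ℂ f Ω) (b : ℂ) :
    DifferentiableOn ℂ (fun a => f (a, b)) {a | (a, b) ∈ Ω} :=
  hf.comp (by fun_prop) fun _ h => h

/-- The Taylor coefficients in the first variable are holomorphic in the second one. -/
theorem differentiableOn_taylorCoeff (hΩ : IsCompleteReinhardt Ω) (hf : DifferentiableOn ℂ f Ω)
    (m : ℕ) :
    DifferentiableOn ℂ (fun b => taylorCoeff (fun a => f (a, b)) m) {b | (0, b) ∈ Ω} := by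
  intro b₀ hb₀
  apply DifferentiableAt.differentiableWithinAt
  obtain ⟨ε, hε, hball⟩ := Metric.isOpen_iff.1 hΩ.isOpen _ hb₀
  -- The first variable runs over the circle of radius `r`; discs of radius `r` about points within
  -- `r` of `b₀` stay within `2 * r`, where `f` is bounded by `C`. Cauchy's estimate on such a disc
  -- gives the dominating constant `C / r` for differentiation under the integral.
  set r := ε / 4 with hr
  have hr0 : 0 < r := by positivity
  have hmem : ∀ a b : ℂ, ‖a‖ ≤ r → dist b b₀ ≤ 2 * r → (a, b) ∈ Metric.closedBall ((0 : ℂ), b₀) (2 * r) := by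
    intro a b ha hb
    rw [Metric.mem_closedBall, Prod.dist_eq, dist_zero_right]
    exact max_le (by simpa using ha.trans (by linarith)) hb
  have hsub : Metric.closedBall ((0 : ℂ), b₀) (2 * r) ⊆ Ω :=
    (Metric.closedBall_subset_ball (by linarith)).trans hball
  obtain ⟨C, hC⟩ := (isCompact_closedBall ((0 : ℂ), b₀) (2 * r)).exists_bound_of_continuousOn
    (hf.continuousOn.mono hsub)
  let c : ℝ → ℂ := fun θ => Complex.exp (θ * Complex.I) * r
  have hc : ∀ θ, ‖c θ‖ ≤ r := fun θ => by
    simp [c, Complex.norm_exp_ofReal_mul_I, abs_of_pos hr0]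
  have hcc : Continuous c := by fun_prop
  have he : ∀ θ : ℝ, ‖Complex.exp (-(θ * Complex.I)) ^ m‖ = 1 := fun θ => by
    rw [norm_pow, Complex.norm_exp]; simp
  have hslice : ∀ a x : ℂ, ‖a‖ ≤ r → dist x b₀ ≤ 2 * r →
      HasDerivAt (fun b => f (a, b)) (fderiv ℂ f (a, x) (0, 1)) x := by
    intro a x ha hx
    have h1 := (hf.differentiableAt (hΩ.isOpen.mem_nhds (hsub (hmem a x ha hx)))).hasFDerivAt
    exact h1.comp_hasDerivAt x ((hasDerivAt_const x a).prodMk (hasDerivAt_id x))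
  have key := intervalIntegral.hasDerivAt_integral_of_dominated_loc_of_deriv_le
    (μ := volume) (a := 0) (b := 2 * Real.pi) (s := Metric.ball b₀ r) (x₀ := b₀)
    (F := fun b θ => f (c θ, b) * Complex.exp (-(θ * Complex.I)) ^ m)
    (F' := fun b θ => fderiv ℂ f (c θ, b) (0, 1) * Complex.exp (-(θ * Complex.I)) ^ m)
    (bound := fun _ => C / r) (Metric.ball_mem_nhds _ hr0)
  have hcont : ∀ x ∈ Metric.ball b₀ r,
      Continuous fun θ : ℝ => f (c θ, x) * Complex.exp (-(θ * Complex.I)) ^ m := by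
    intro x hx
    have h1 : Continuous fun θ : ℝ => f (c θ, x) :=
      hf.continuousOn.comp_continuous (by fun_prop)
        fun θ => hsub (hmem _ _ (hc θ) (by have := Metric.mem_ball.1 hx; linarith))
    exact h1.mul (by fun_prop)
  have key := (key
    (eventually_of_mem (Metric.ball_mem_nhds _ hr0) fun x hx => (hcont x hx).aestronglyMeasurable)
    ((hcont b₀ (Metric.mem_ball_self hr0)).intervalIntegrable _ _)
    (by
      refine Measurable.aestronglyMeasurable (Measurable.mul ?_ ?_)
      · exact (measurable_fderiv_apply_const ℂ f ((0 : ℂ), (1 : ℂ))).comp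
          (by fun_prop : Measurable fun θ : ℝ => (c θ, b₀))
      · fun_prop)
    (Eventually.of_forall fun θ _ x hx => by
      rw [norm_mul, he, mul_one, ← (hslice (c θ) x (hc θ)
        (by have := Metric.mem_ball.1 hx; linarith)).deriv]
      have hxy : ∀ y ∈ Metric.closedBall x r, dist y b₀ ≤ 2 * r := fun y hy => by
        have := dist_triangle y x b₀
        have := Metric.mem_ball.1 hx
        have := Metric.mem_closedBall.1 hy
        linarith
      refine Complex.norm_deriv_le_of_forall_mem_sphere_norm_le hr0 ?_ ?_
      · refine DifferentiableOn.diffContOnCl fun y hy => ?_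
        rw [closure_ball _ hr0.ne'] at hy
        exact (hslice _ y (hc θ) (hxy y hy)).differentiableAt.differentiableWithinAt
      · intro y hy
        exact hC _ (hmem _ _ (hc θ) (hxy y (Metric.sphere_subset_closedBall hy))))
    (by simp)
    (Eventually.of_forall fun θ _ x hx =>
      (hslice _ x (hc θ) (by have := Metric.mem_ball.1 hx; linarith)).mul_const _)).2
  have hne : (2 * Real.pi * (r : ℂ) ^ m) ≠ 0 := by
    simp [hr0.ne', Real.pi_ne_zero]
  refine (key.differentiableAt.div_const (2 * Real.pi * (r : ℂ) ^ m)).congr_of_eventuallyEq ?_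
  filter_upwards [Metric.ball_mem_nhds b₀ hr0] with b hb
  have hrb : ((r : ℂ), b) ∈ Ω := hsub (hmem _ _ (by simp [abs_of_pos hr0])
    (by have := Metric.mem_ball.1 hb; linarith))
  rw [eq_div_iff hne, (hΩ.slice_fst b).integral_rotate (hΩ.differentiableOn_fst hf b) hrb m]
  ring

/-- The Taylor coefficients of `f` at the origin. -/
noncomputable def coeff (f : ℂ × ℂ → ℂ) (k : ℕ × ℕ) : ℂ :=
  taylorCoeff (fun b => taylorCoeff (fun a => f (a, b)) k.1) k.2

theorem hasSum_coeff_fst (hΩ : IsCompleteReinhardt Ω) (hf : DifferentiableOn ℂ f Ω)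
    {z : ℂ × ℂ} (hz : z ∈ Ω) :
    HasSum (fun m => taylorCoeff (fun a => f (a, z.2)) m * z.1 ^ m) (f z) :=
  (hΩ.slice_fst z.2).hasSum_taylorCoeff (hΩ.differentiableOn_fst hf z.2) hz

theorem hasSum_coeff_snd (hΩ : IsCompleteReinhardt Ω) (hf : DifferentiableOn ℂ f Ω)
    {z : ℂ × ℂ} (hz : z ∈ Ω) (m : ℕ) :
    HasSum (fun n => coeff f (m, n) * z.2 ^ n) (taylorCoeff (fun a => f (a, z.2)) m) :=
  (hΩ.slice_snd 0).hasSum_taylorCoeff (hΩ.differentiableOn_taylorCoeff hf m)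
    (hΩ.mem_of_norm_le z hz _ (by simp) le_rfl)

theorem measurePreserving_rotate (θ : ℝ) :
    MeasurePreserving (fun a : ℂ => Complex.exp (θ * Complex.I) * a) := by
  have h := (rotation (Circle.exp θ)).measurePreserving
  have e : ⇑(rotation (Circle.exp θ)) = fun a : ℂ => Complex.exp (θ * Complex.I) * a := by
    funext a
    simp [rotation_apply, Circle.coe_exp]
  rwa [e] at h

theorem measurePreserving_rotate_fst (hΩ : IsCompleteReinhardt Ω) (θ : ℝ) :
    MeasurePreserving (fun z : ℂ × ℂ => (Complex.exp (θ * Complex.I) * z.1, z.2))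
      (volume.restrict Ω) (volume.restrict Ω) := by
  have h : MeasurePreserving (fun z : ℂ × ℂ => (Complex.exp (θ * Complex.I) * z.1, z.2)) :=
    (measurePreserving_rotate θ).prod (MeasurePreserving.id _)
  have hpre : (fun z : ℂ × ℂ => (Complex.exp (θ * Complex.I) * z.1, z.2)) ⁻¹' Ω = Ω := by
    ext z
    have : ‖Complex.exp (θ * Complex.I) * z.1‖ = ‖z.1‖ := by
      simp [Complex.norm_exp_ofReal_mul_I]
    exact ⟨fun hz => hΩ.mem_of_norm_le _ hz _ this.ge le_rfl,
      fun hz => hΩ.mem_of_norm_le _ hz _ this.le le_rfl⟩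
  have h1 := h.restrict_preimage hΩ.isOpen.measurableSet
  rwa [hpre] at h1

theorem measurePreserving_rotate_snd (hΩ : IsCompleteReinhardt Ω) (θ : ℝ) :
    MeasurePreserving (fun z : ℂ × ℂ => (z.1, Complex.exp (θ * Complex.I) * z.2))
      (volume.restrict Ω) (volume.restrict Ω) := by
  have h : MeasurePreserving (fun z : ℂ × ℂ => (z.1, Complex.exp (θ * Complex.I) * z.2)) :=
    (MeasurePreserving.id _).prod (measurePreserving_rotate θ)
  have hpre : (fun z : ℂ × ℂ => (z.1, Complex.exp (θ * Complex.I) * z.2)) ⁻¹' Ω = Ω := by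
    ext z
    have : ‖Complex.exp (θ * Complex.I) * z.2‖ = ‖z.2‖ := by
      simp [Complex.norm_exp_ofReal_mul_I]
    exact ⟨fun hz => hΩ.mem_of_norm_le _ hz _ le_rfl this.ge,
      fun hz => hΩ.mem_of_norm_le _ hz _ le_rfl this.le⟩
  have h1 := h.restrict_preimage hΩ.isOpen.measurableSet
  rwa [hpre] at h1

theorem _root_.conj_exp_ofReal_mul_I (θ : ℝ) :
    star (Complex.exp (θ * Complex.I)) = Complex.exp (-(θ * Complex.I)) := by
  rw [Complex.star_def, ← Complex.exp_conj]
  simp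

/-- The monomial with exponents `k`. -/
def _root_.monom (k : ℕ × ℕ) (z : ℂ × ℂ) : ℂ := z.1 ^ k.1 * z.2 ^ k.2

/-- The squared `L²`-norm of a monomial. -/
noncomputable def _root_.monomNormSq (Ω : Set (ℂ × ℂ)) (k : ℕ × ℕ) : ℝ :=
  ∫ w in Ω, ‖monom k w‖ ^ 2

/-- Averaging the integrand over rotations of each coordinate in turn leaves only the Taylor term of
bi-degree `k`, so no expansion of `f` has to be integrated over Ω. -/
theorem integral_mul_conj_monom (hΩ : IsCompleteReinhardt Ω) (hf : DifferentiableOn ℂ f Ω)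
    (k : ℕ × ℕ) (hi : IntegrableOn (fun w => f w * star (monom k w)) Ω) :
    ∫ w in Ω, f w * star (monom k w) = coeff f k * monomNormSq Ω k := by
  have hpi : (2 * Real.pi : ℂ) ≠ 0 := by simp [Real.pi_ne_zero]
  obtain ⟨h1, e1⟩ := integral_eq_average_of_measurePreserving
    (T := fun θ z => (Complex.exp (θ * Complex.I) * z.1, z.2))
    (by unfold Function.uncurry; fun_prop) hΩ.measurePreserving_rotate_fst hi
  have a1 : ∀ w ∈ Ω, ∫ θ in (0 : ℝ)..2 * Real.pi,
      f (Complex.exp (θ * Complex.I) * w.1, w.2) *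
        star (monom k (Complex.exp (θ * Complex.I) * w.1, w.2)) =
      2 * Real.pi * (taylorCoeff (fun a => f (a, w.2)) k.1 * w.1 ^ k.1 * star (monom k w)) := by
    intro w hw
    have := (hΩ.slice_fst w.2).integral_rotate (hΩ.differentiableOn_fst hf w.2) hw k.1
    rw [← mul_assoc, ← this, ← intervalIntegral.integral_mul_const]
    congr 1
    funext θ
    simp only [monom, star_mul', star_pow, conj_exp_ofReal_mul_I, mul_pow]
    ring
  rw [setIntegral_congr_fun hΩ.isOpen.measurableSet a1, integral_const_mul] at e1
  have e1 := mul_left_cancel₀ hpi e1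
  have h1 : IntegrableOn (fun w => taylorCoeff (fun a => f (a, w.2)) k.1 * w.1 ^ k.1 *
      star (monom k w)) Ω := by
    have h2 := (integrableOn_congr_fun a1 hΩ.isOpen.measurableSet).1 h1
    refine (integrable_const_mul_iff (IsUnit.mk0 _ hpi) _).1 h2
  obtain ⟨-, e2⟩ := integral_eq_average_of_measurePreserving
    (T := fun θ z => (z.1, Complex.exp (θ * Complex.I) * z.2))
    (by unfold Function.uncurry; fun_prop) hΩ.measurePreserving_rotate_snd h1
  have a2 : ∀ w ∈ Ω, ∫ θ in (0 : ℝ)..2 * Real.pi,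
      taylorCoeff (fun a => f (a, Complex.exp (θ * Complex.I) * w.2)) k.1 * w.1 ^ k.1 *
        star (monom k (w.1, Complex.exp (θ * Complex.I) * w.2)) =
      2 * Real.pi * (coeff f k * ((‖monom k w‖ ^ 2 : ℝ) : ℂ)) := by
    intro w hw
    have := (hΩ.slice_snd 0).integral_rotate (hΩ.differentiableOn_taylorCoeff hf k.1)
      (hΩ.mem_of_norm_le w hw _ (by simp) le_rfl) k.2
    have h3 : ((‖monom k w‖ ^ 2 : ℝ) : ℂ) = w.1 ^ k.1 * star (monom k w) * w.2 ^ k.2 := by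
      push_cast
      rw [← Complex.mul_conj', monom]
      simp only [Complex.star_def]
      ring
    rw [h3, coeff]
    have h4 : (2 * Real.pi : ℂ) * (taylorCoeff (fun b => taylorCoeff (fun a => f (a, b)) k.1) k.2 *
        (w.1 ^ k.1 * star (monom k w) * w.2 ^ k.2)) = 2 * Real.pi *
        (taylorCoeff (fun b => taylorCoeff (fun a => f (a, b)) k.1) k.2 * w.2 ^ k.2) *
        (w.1 ^ k.1 * star (monom k w)) := by ring
    rw [h4, ← this, ← intervalIntegral.integral_mul_const]
    congr 1
    funext θ
    simp only [monom, star_mul', star_pow, conj_exp_ofReal_mul_I, mul_pow]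
    ring
  rw [setIntegral_congr_fun hΩ.isOpen.measurableSet a2, integral_const_mul] at e2
  rw [e1, mul_left_cancel₀ hpi e2, integral_const_mul, integral_complex_ofReal]
  rfl

end IsCompleteReinhardt

/-! ### The monomial series is the Bergman kernel of a Reinhardt domain. -/

theorem norm_monom (k : ℕ × ℕ) (z : ℂ × ℂ) : ‖monom k z‖ = ‖z.1‖ ^ k.1 * ‖z.2‖ ^ k.2 := by
  simp [monom]

theorem continuous_monom (k : ℕ × ℕ) : Continuous (monom k) := by
  unfold monom
  fun_prop

theorem summable_mul_geometric_prod {a b : ℝ} (ha : 0 ≤ a) (ha' : a < 1) (hb : 0 ≤ b)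
    (hb' : b < 1) (i j : ℕ) :
    Summable fun k : ℕ × ℕ => ((k.1 : ℝ) ^ i * a ^ k.1) * ((k.2 : ℝ) ^ j * b ^ k.2) := by
  have h1 : Summable fun n : ℕ => (n : ℝ) ^ i * a ^ n :=
    summable_pow_mul_geometric_of_norm_lt_one i (by rwa [Real.norm_of_nonneg ha])
  have h2 : Summable fun n : ℕ => (n : ℝ) ^ j * b ^ n :=
    summable_pow_mul_geometric_of_norm_lt_one j (by rwa [Real.norm_of_nonneg hb])
  exact h1.mul_of_nonneg h2 (fun n => by positivity) (fun n => by positivity)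

/-- The Bergman kernel of a Reinhardt domain as a series. -/
noncomputable def monomKernel (Ω : Set (ℂ × ℂ)) (z w : ℂ × ℂ) : ℂ :=
  ∑' k : ℕ × ℕ, monom k z * star (monom k w) / monomNormSq Ω k

namespace IsCompleteReinhardt

variable {Ω : Set (ℂ × ℂ)} {f : ℂ × ℂ → ℂ} {z : ℂ × ℂ}

theorem integrableOn_of_continuous (hΩ : IsCompleteReinhardt Ω) {E : Type*}
    [NormedAddCommGroup E] {g : ℂ × ℂ → E} (hg : Continuous g) : IntegrableOn g Ω := by
  refine IntegrableOn.mono_set ?_ subset_closure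
  exact hg.continuousOn.integrableOn_compact hΩ.isBounded.isCompact_closure

theorem integrableOn_norm_monom_sq (hΩ : IsCompleteReinhardt Ω) (k : ℕ × ℕ) :
    IntegrableOn (fun w => ‖monom k w‖ ^ 2) Ω :=
  hΩ.integrableOn_of_continuous ((continuous_monom k).norm.pow 2)

theorem memLp_monom (hΩ : IsCompleteReinhardt Ω) (k : ℕ × ℕ) :
    MemLp (monom k) 2 (volume.restrict Ω) :=
  (memLp_two_iff_integrable_sq_norm (continuous_monom k).aestronglyMeasurable).2
    (hΩ.integrableOn_norm_monom_sq k)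

/-- Ω contains a product `A` of annuli lying strictly beyond `z` in both coordinates. There the
monomial has modulus at least ρ₁^k₁ ρ₂^k₂, so its squared norm is at least vol(A) times the square
of this, and M = vol(A)^(-1/2) works. The strict gap between |zᵢ| and ρᵢ supplies the geometric
decay behind all later convergence. -/
theorem exists_monom_bound (hΩ : IsCompleteReinhardt Ω) (hz : z ∈ Ω) :
    ∃ ρ₁ ρ₂ M : ℝ, ‖z.1‖ < ρ₁ ∧ ‖z.2‖ < ρ₂ ∧ 0 < M ∧
      ∀ k : ℕ × ℕ, ρ₁ ^ k.1 * ρ₂ ^ k.2 ≤ M * √(monomNormSq Ω k) := by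
  have h1 : (((‖z.1‖ : ℝ) : ℂ), ((‖z.2‖ : ℝ) : ℂ)) ∈ Ω :=
    hΩ.mem_of_norm_le z hz _ (by simp) (by simp)
  obtain ⟨ε, hε, hb⟩ := Metric.isOpen_iff.1 hΩ.isOpen _ h1
  have h2 : (((‖z.1‖ + ε / 2 : ℝ) : ℂ), ((‖z.2‖ + ε / 2 : ℝ) : ℂ)) ∈ Ω := by
    apply hb
    rw [Metric.mem_ball, Prod.dist_eq, dist_eq_norm, dist_eq_norm, ← Complex.ofReal_sub,
      ← Complex.ofReal_sub, Complex.norm_real, Complex.norm_real]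
    simp [abs_of_pos hε, hε]
  set ρ₁ := ‖z.1‖ + ε / 4 with hρ₁
  set ρ₂ := ‖z.2‖ + ε / 4 with hρ₂
  have hρ₁0 : 0 < ρ₁ := by positivity
  have hρ₂0 : 0 < ρ₂ := by positivity
  let A : Set (ℂ × ℂ) := {w | (ρ₁ < ‖w.1‖ ∧ ‖w.1‖ < ‖z.1‖ + ε / 2) ∧
    (ρ₂ < ‖w.2‖ ∧ ‖w.2‖ < ‖z.2‖ + ε / 2)}
  have hAo : IsOpen A :=
    ((isOpen_lt continuous_const continuous_fst.norm).and
      (isOpen_lt continuous_fst.norm continuous_const)).and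
      ((isOpen_lt continuous_const continuous_snd.norm).and
      (isOpen_lt continuous_snd.norm continuous_const))
  have hAΩ : A ⊆ Ω := fun w hw => by
    refine hΩ.mem_of_norm_le _ h2 w ?_ ?_
    · rw [Complex.norm_real, Real.norm_of_nonneg (by positivity)]
      exact hw.1.2.le
    · rw [Complex.norm_real, Real.norm_of_nonneg (by positivity)]
      exact hw.2.2.le
  have hAne : A.Nonempty := by
    refine ⟨(((‖z.1‖ + ε / 3 : ℝ) : ℂ), ((‖z.2‖ + ε / 3 : ℝ) : ℂ)), ?_⟩
    have e1 : ‖((‖z.1‖ + ε / 3 : ℝ) : ℂ)‖ = ‖z.1‖ + ε / 3 := by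
      rw [Complex.norm_real, Real.norm_of_nonneg (by positivity)]
    have e2 : ‖((‖z.2‖ + ε / 3 : ℝ) : ℂ)‖ = ‖z.2‖ + ε / 3 := by
      rw [Complex.norm_real, Real.norm_of_nonneg (by positivity)]
    simp only [A, Set.mem_ofPred_eq, e1, e2]
    refine ⟨⟨?_, ?_⟩, ?_, ?_⟩ <;> linarith
  have hAfin : volume A ≠ ⊤ := ((hΩ.isBounded.subset hAΩ).measure_lt_top).ne
  have hδ : 0 < volume.real A :=
    ENNReal.toReal_pos (hAo.measure_pos volume hAne).ne' hAfin
  refine ⟨ρ₁, ρ₂, (√(volume.real A))⁻¹, by linarith, by linarith, by positivity, fun k => ?_⟩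
  have hN : volume.real A * (ρ₁ ^ k.1 * ρ₂ ^ k.2) ^ 2 ≤ monomNormSq Ω k := by
    calc volume.real A * (ρ₁ ^ k.1 * ρ₂ ^ k.2) ^ 2
        = ∫ w in A, (ρ₁ ^ k.1 * ρ₂ ^ k.2) ^ 2 := by simp
      _ ≤ ∫ w in A, ‖monom k w‖ ^ 2 := by
          refine setIntegral_mono_on (integrableOn_const hAfin)
            ((hΩ.integrableOn_norm_monom_sq k).mono_set hAΩ)
            hAo.measurableSet fun w hw => ?_
          rw [norm_monom]
          gcongr
          · exact hw.1.1.le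
          · exact hw.2.1.le
      _ ≤ monomNormSq Ω k :=
          setIntegral_mono_set (hΩ.integrableOn_norm_monom_sq k)
            (Eventually.of_forall fun w => by positivity) hAΩ.eventuallyLE
  rw [inv_mul_eq_div, le_div_iff₀ (by positivity), mul_comm]
  refine Real.le_sqrt_of_sq_le ?_
  rwa [mul_pow, Real.sq_sqrt hδ.le]

theorem monomNormSq_pos (hΩ : IsCompleteReinhardt Ω) (hz : z ∈ Ω) (k : ℕ × ℕ) :
    0 < monomNormSq Ω k := by
  obtain ⟨ρ₁, ρ₂, M, h1, h2, hM, h⟩ := hΩ.exists_monom_bound hz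
  have h1' : 0 < ρ₁ := (norm_nonneg _).trans_lt h1
  have h2' : 0 < ρ₂ := (norm_nonneg _).trans_lt h2
  have h3 : 0 < M * √(monomNormSq Ω k) := lt_of_lt_of_le (by positivity) (h k)
  exact Real.sqrt_pos.1 (pos_of_mul_pos_right h3 hM.le)

theorem summable_norm_monom_div (hΩ : IsCompleteReinhardt Ω) (hz : z ∈ Ω) :
    Summable fun k => ‖monom k z‖ / √(monomNormSq Ω k) := by
  obtain ⟨ρ₁, ρ₂, M, h1, h2, hM, h⟩ := hΩ.exists_monom_bound hz
  have h1' : 0 < ρ₁ := (norm_nonneg _).trans_lt h1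
  have h2' : 0 < ρ₂ := (norm_nonneg _).trans_lt h2
  have hs := (summable_mul_geometric_prod (a := ‖z.1‖ / ρ₁) (b := ‖z.2‖ / ρ₂) (by positivity)
    ((div_lt_one h1').2 h1) (by positivity) ((div_lt_one h2').2 h2) 0 0).mul_left M
  refine hs.of_nonneg_of_le (fun k => by positivity) fun k => ?_
  have hN := Real.sqrt_pos.2 (hΩ.monomNormSq_pos hz k)
  rw [norm_monom, div_le_iff₀ hN]
  simp only [pow_zero, one_mul, div_pow]
  have e : M * (‖z.1‖ ^ k.1 / ρ₁ ^ k.1 * (‖z.2‖ ^ k.2 / ρ₂ ^ k.2)) * √(monomNormSq Ω k) =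
    (‖z.1‖ ^ k.1 * ‖z.2‖ ^ k.2) * ((M * √(monomNormSq Ω k)) / (ρ₁ ^ k.1 * ρ₂ ^ k.2)) := by
    field_simp
  rw [e]
  refine le_mul_of_one_le_right (by positivity) ?_
  rw [one_le_div (by positivity)]
  exact h k

theorem norm_kernel_term (hΩ : IsCompleteReinhardt Ω) (hz : z ∈ Ω) (w : ℂ × ℂ) (k : ℕ × ℕ) :
    ‖monom k z * star (monom k w) / monomNormSq Ω k‖ =
      ‖monom k z‖ / √(monomNormSq Ω k) * (‖monom k w‖ / √(monomNormSq Ω k)) := by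
  have hN := hΩ.monomNormSq_pos hz k
  rw [norm_div, norm_mul, norm_star, Complex.norm_real, Real.norm_of_nonneg hN.le,
    div_mul_div_comm, Real.mul_self_sqrt hN.le]

theorem hasSum_monomKernel (hΩ : IsCompleteReinhardt Ω) (hz : z ∈ Ω) {w : ℂ × ℂ} (hw : w ∈ Ω) :
    HasSum (fun k => monom k z * star (monom k w) / monomNormSq Ω k) (monomKernel Ω z w) := by
  refine Summable.hasSum (Summable.of_norm ?_)
  simp_rw [hΩ.norm_kernel_term hz w]
  exact (hΩ.summable_norm_monom_div hz).mul_of_nonneg (hΩ.summable_norm_monom_div hw)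
    (fun _ => by positivity) (fun _ => by positivity) |>.comp_injective
      (i := fun k : ℕ × ℕ => (k, k)) fun a b h => (Prod.mk.inj h).1

theorem hasFDerivAt_monom (k : ℕ × ℕ) (w : ℂ × ℂ) :
    HasFDerivAt (monom k)
      (w.1 ^ k.1 • ((k.2 * w.2 ^ (k.2 - 1)) • ContinuousLinearMap.snd ℂ ℂ ℂ) +
        w.2 ^ k.2 • ((k.1 * w.1 ^ (k.1 - 1)) • ContinuousLinearMap.fst ℂ ℂ ℂ)) w := by
  have h1 := (hasFDerivAt_fst (𝕜 := ℂ) (p := w) (E := ℂ) (F := ℂ)).pow k.1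
  have h2 := (hasFDerivAt_snd (𝕜 := ℂ) (p := w) (E := ℂ) (F := ℂ)).pow k.2
  refine (h1.mul h2).congr_fderiv ?_
  ext <;> simp

theorem norm_fderiv_monom_le {k : ℕ × ℕ} {w : ℂ × ℂ} {r₁ r₂ : ℝ} (h₁ : ‖w.1‖ ≤ r₁)
    (h₂ : ‖w.2‖ ≤ r₂) (hr₁ : 0 < r₁) (hr₂ : 0 < r₂) :
    ‖w.1 ^ k.1 • ((k.2 * w.2 ^ (k.2 - 1)) • ContinuousLinearMap.snd ℂ ℂ ℂ) +
        w.2 ^ k.2 • ((k.1 * w.1 ^ (k.1 - 1)) • ContinuousLinearMap.fst ℂ ℂ ℂ)‖ ≤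
      r₁ ^ k.1 * r₂ ^ k.2 * (k.1 / r₁ + k.2 / r₂) := by
  have hp : ∀ (n : ℕ) (x : ℂ) (r : ℝ), ‖x‖ ≤ r → 0 < r →
      ‖(n : ℂ) * x ^ (n - 1)‖ ≤ n * r ^ n / r := by
    intro n x r hx hr
    rcases n with _ | n
    · simp
    · rw [norm_mul, norm_pow, Complex.norm_natCast, pow_succ, ← mul_assoc,
        mul_div_cancel_right₀ _ hr.ne']
      simp only [Nat.add_sub_cancel]
      gcongr
  refine (norm_add_le _ _).trans ?_
  rw [norm_smul, norm_smul, norm_smul, norm_smul, norm_pow, norm_pow]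
  calc ‖w.1‖ ^ k.1 * (‖(k.2 : ℂ) * w.2 ^ (k.2 - 1)‖ * ‖ContinuousLinearMap.snd ℂ ℂ ℂ‖) +
        ‖w.2‖ ^ k.2 * (‖(k.1 : ℂ) * w.1 ^ (k.1 - 1)‖ * ‖ContinuousLinearMap.fst ℂ ℂ ℂ‖)
      ≤ r₁ ^ k.1 * ((k.2 * r₂ ^ k.2 / r₂) * 1) + r₂ ^ k.2 * ((k.1 * r₁ ^ k.1 / r₁) * 1) := by
        gcongr
        · exact hp _ _ _ h₂ hr₂
        · exact ContinuousLinearMap.norm_snd_le ℂ ℂ ℂ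
        · exact hp _ _ _ h₁ hr₁
        · exact ContinuousLinearMap.norm_fst_le ℂ ℂ ℂ
    _ = _ := by field_simp; ring

theorem differentiableOn_monomKernel (hΩ : IsCompleteReinhardt Ω) (hz : z ∈ Ω) :
    DifferentiableOn ℂ (fun w => star (monomKernel Ω z w)) Ω := by
  intro w₀ hw₀
  apply DifferentiableAt.differentiableWithinAt
  obtain ⟨ρ₁, ρ₂, M, h1, h2, hM, h⟩ := hΩ.exists_monom_bound hw₀
  obtain ⟨r₁, hr₁, hr₁'⟩ := exists_between h1
  obtain ⟨r₂, hr₂, hr₂'⟩ := exists_between h2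
  have hr₁0 : 0 < r₁ := (norm_nonneg _).trans_lt hr₁
  have hr₂0 : 0 < r₂ := (norm_nonneg _).trans_lt hr₂
  have hρ₁0 : 0 < ρ₁ := hr₁0.trans hr₁'
  have hρ₂0 : 0 < ρ₂ := hr₂0.trans hr₂'
  set s : Set (ℂ × ℂ) := Metric.ball 0 r₁ ×ˢ Metric.ball 0 r₂ with hs
  have hw₀s : w₀ ∈ s := ⟨by simpa using hr₁, by simpa using hr₂⟩
  obtain ⟨B, hB⟩ : ∃ B, ∀ k, ‖monom k z‖ / √(monomNormSq Ω k) ≤ B :=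
    ⟨_, fun k => (hΩ.summable_norm_monom_div hz).le_tsum k fun _ _ => by positivity⟩
  have e : (fun w => star (monomKernel Ω z w)) =
      fun w => ∑' k, (star (monom k z) / monomNormSq Ω k) • monom k w := by
    funext w
    rw [monomKernel, tsum_star]
    congr 1
    funext k
    simp [mul_comm, div_eq_mul_inv, mul_assoc, mul_left_comm]
  rw [e]
  have q₁ : r₁ / ρ₁ < 1 := (div_lt_one hρ₁0).2 hr₁'
  have q₂ : r₂ / ρ₂ < 1 := (div_lt_one hρ₂0).2 hr₂'
  have hu : Summable fun k : ℕ × ℕ =>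
      B * (M * ((r₁ / ρ₁) ^ k.1 * (r₂ / ρ₂) ^ k.2 * (k.1 / r₁ + k.2 / r₂))) := by
    refine Summable.mul_left _ (Summable.mul_left _ ?_)
    have s1 := (summable_mul_geometric_prod (by positivity) q₁ (by positivity) q₂ 1 0).mul_left r₁⁻¹
    have s2 := (summable_mul_geometric_prod (by positivity) q₁ (by positivity) q₂ 0 1).mul_left r₂⁻¹
    refine (s1.add s2).congr fun k => ?_
    simp only [pow_zero, pow_one]
    ring
  refine (hasFDerivAt_tsum_of_isPreconnected hu (Metric.isOpen_ball.prod Metric.isOpen_ball)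
    ((convex_ball _ _).prod (convex_ball _ _)).isPreconnected
    (fun k w _ => (hasFDerivAt_monom k w).const_smul (star (monom k z) / (monomNormSq Ω k : ℂ)))
    (fun k w hw => ?_) hw₀s ?_ hw₀s).differentiableAt
  · have hN := hΩ.monomNormSq_pos hz k
    have hw1 : ‖w.1‖ ≤ r₁ := by simpa using (Metric.mem_ball.1 hw.1).le
    have hw2 : ‖w.2‖ ≤ r₂ := by simpa using (Metric.mem_ball.1 hw.2).le
    rw [norm_smul, norm_div, norm_star, Complex.norm_real, Real.norm_of_nonneg hN.le]
    -- The squared norm is split into two square roots: one bounds the factor in `z` by `B`, the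
    -- other absorbs the growth of the derivative in `w`.
    nth_rewrite 1 [← Real.mul_self_sqrt hN.le]
    rw [← div_div, div_eq_mul_inv _ √(monomNormSq Ω k), mul_assoc]
    refine mul_le_mul (hB k) ?_ (by positivity) ((by positivity : (0 : ℝ) ≤ _).trans (hB k))
    rw [inv_mul_le_iff₀ (Real.sqrt_pos.2 hN)]
    refine (norm_fderiv_monom_le hw1 hw2 hr₁0 hr₂0).trans ?_
    have e2 : √(monomNormSq Ω k) *
        (M * ((r₁ / ρ₁) ^ k.1 * (r₂ / ρ₂) ^ k.2 * (k.1 / r₁ + k.2 / r₂))) =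
        (r₁ ^ k.1 * r₂ ^ k.2 * (k.1 / r₁ + k.2 / r₂)) *
          ((M * √(monomNormSq Ω k)) / (ρ₁ ^ k.1 * ρ₂ ^ k.2)) := by
      rw [div_pow, div_pow]
      field_simp
    rw [e2]
    refine le_mul_of_one_le_right (by positivity) ?_
    rw [one_le_div (by positivity)]
    exact h k
  · have := (hΩ.hasSum_monomKernel hz hw₀).star.summable
    refine this.congr fun k => ?_
    simp [mul_comm, div_eq_mul_inv, mul_assoc, mul_left_comm]

theorem eLpNorm_kernel_term (hΩ : IsCompleteReinhardt Ω) (hz : z ∈ Ω) (k : ℕ × ℕ) :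
    eLpNorm (fun w => star (monom k z * star (monom k w) / monomNormSq Ω k)) 2
      (volume.restrict Ω) = ENNReal.ofReal (‖monom k z‖ / √(monomNormSq Ω k)) := by
  have hN := hΩ.monomNormSq_pos hz k
  have e : (fun w => star (monom k z * star (monom k w) / monomNormSq Ω k)) =
      (star (monom k z) / (monomNormSq Ω k : ℂ)) • monom k := by
    funext w
    simp [mul_comm, div_eq_mul_inv, mul_assoc, mul_left_comm]
  rw [e, eLpNorm_const_smul, (hΩ.memLp_monom k).eLpNorm_eq_integral_rpow_norm two_ne_zero
    ENNReal.ofNat_ne_top, ← ofReal_norm, ← ENNReal.ofReal_mul (norm_nonneg _)]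
  congr 1
  have e2 : ∫ w in Ω, ‖monom k w‖ ^ (ENNReal.toReal 2) = monomNormSq Ω k := by
    simp [monomNormSq]
  rw [e2, norm_div, norm_star, Complex.norm_real, Real.norm_of_nonneg hN.le]
  simp only [ENNReal.toReal_ofNat]
  rw [← one_div, ← Real.sqrt_eq_rpow]
  nth_rewrite 1 [← Real.mul_self_sqrt hN.le]
  have := (Real.sqrt_pos.2 hN).ne'
  field_simp

/-- The L² norms of the terms are summable, so the partial sums are bounded in L², and Fatou's lemma
passes the bound to the pointwise limit. The index set is enumerated by ℕ to obtain a sequence. -/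
theorem memLp_monomKernel (hΩ : IsCompleteReinhardt Ω) (hz : z ∈ Ω) :
    MemLp (fun w => star (monomKernel Ω z w)) 2 (volume.restrict Ω) := by
  refine ⟨(hΩ.differentiableOn_monomKernel hz).continuousOn.aestronglyMeasurable
    hΩ.isOpen.measurableSet, ?_⟩
  let e := Nat.pairEquiv.symm
  let F : ℕ → ℂ × ℂ → ℂ := fun n w =>
    star (monom (e n) z * star (monom (e n) w) / monomNormSq Ω (e n))
  have hF : ∀ n, AEStronglyMeasurable (F n) (volume.restrict Ω) := fun n => by
    refine Continuous.aestronglyMeasurable ?_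
    have := continuous_monom (e n)
    fun_prop
  have hs := hΩ.summable_norm_monom_div hz
  have hle : ∀ n, eLpNorm (∑ i ∈ Finset.range n, F i) 2 (volume.restrict Ω) ≤
      ENNReal.ofReal (∑' k, ‖monom k z‖ / √(monomNormSq Ω k)) := fun n => by
    refine (eLpNorm_sum_le (fun i _ => hF i) one_le_two).trans ?_
    have : ∀ i, eLpNorm (F i) 2 (volume.restrict Ω) =
        ENNReal.ofReal (‖monom (e i) z‖ / √(monomNormSq Ω (e i))) := fun i =>
      hΩ.eLpNorm_kernel_term hz (e i)
    simp_rw [this]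
    rw [← ENNReal.ofReal_sum_of_nonneg fun _ _ => by positivity, ← e.tsum_eq]
    exact ENNReal.ofReal_le_ofReal
      ((e.summable_iff.2 hs).sum_le_tsum _ fun _ _ => div_nonneg (norm_nonneg _) (Real.sqrt_nonneg _))
  refine lt_of_le_of_lt (Lp.eLpNorm_lim_le_liminf_eLpNorm (f := fun n => ∑ i ∈ Finset.range n, F i)
    (fun n => Finset.aestronglyMeasurable_sum _ fun i _ => hF i) _ ?_) (lt_of_le_of_lt
      (liminf_le_of_le (by isBoundedDefault) fun b hb => ?_)
      (ENNReal.ofReal_lt_top (r := ∑' k, ‖monom k z‖ / √(monomNormSq Ω k))))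
  · filter_upwards [ae_restrict_mem hΩ.isOpen.measurableSet] with w hw
    have := ((e.hasSum_iff.2 (hΩ.hasSum_monomKernel hz hw).star)).tendsto_sum_nat
    simpa [F] using this
  · obtain ⟨n, hn⟩ := hb.exists
    exact hn.trans (hle n)

theorem isBergmanKernel (hΩ : IsCompleteReinhardt Ω) : IsBergmanKernel Ω (monomKernel Ω) where
  conj_mem z hz := ⟨hΩ.differentiableOn_monomKernel hz, hΩ.memLp_monomKernel hz⟩
  reproducing f hf z hz := by
    have hfi : Integrable (fun w => ‖f w‖ ^ 2) (volume.restrict Ω) :=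
      (memLp_two_iff_integrable_sq_norm hf.2.1).1 hf.2
    have hint : ∀ k, IntegrableOn (fun w => f w * star (monom k w)) Ω := fun k =>
      hf.2.integrable_mul (hΩ.memLp_monom k).star
    let F : ℕ × ℕ → ℂ × ℂ → ℂ := fun k w =>
      monom k z / monomNormSq Ω k * (f w * star (monom k w))
    have hF : ∀ k, Integrable (F k) (volume.restrict Ω) := fun k => (hint k).const_mul _
    have hsum : Summable fun k => ∫ w in Ω, ‖F k w‖ := by
      -- Instead of Cauchy–Schwarz, ab ≤ a² + b² is used with a = |f| and b the normalised monomial;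
      -- the `+ 1` is the squared norm of the latter.
      refine ((hΩ.summable_norm_monom_div hz).mul_right
        ((∫ w in Ω, ‖f w‖ ^ 2) + 1)).of_nonneg_of_le
        (fun k => by positivity) fun k => ?_
      have hN := hΩ.monomNormSq_pos hz k
      have hN' := Real.sqrt_pos.2 hN
      have e1 : ∫ w in Ω, (‖f w‖ ^ 2 + ‖monom k w‖ ^ 2 / monomNormSq Ω k) =
          (∫ w in Ω, ‖f w‖ ^ 2) + 1 := by
        rw [integral_add hfi ((hΩ.integrableOn_norm_monom_sq k).div_const _), integral_div]
        change _ + monomNormSq Ω k / _ = _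
        rw [div_self hN.ne']
      rw [← e1, ← integral_const_mul]
      refine integral_mono (hF k).norm ((hfi.add ((hΩ.integrableOn_norm_monom_sq k).div_const _)).const_mul _) fun w => ?_
      simp only [F, norm_mul, norm_div, norm_star, Complex.norm_real, Real.norm_of_nonneg hN.le]
      have e2 : ‖monom k z‖ / monomNormSq Ω k * (‖f w‖ * ‖monom k w‖) =
          ‖monom k z‖ / √(monomNormSq Ω k) * (‖f w‖ * (‖monom k w‖ / √(monomNormSq Ω k))) := by
        nth_rewrite 1 [← Real.mul_self_sqrt hN.le]
        field_simp
      have e3 : ‖monom k w‖ ^ 2 / monomNormSq Ω k = (‖monom k w‖ / √(monomNormSq Ω k)) ^ 2 := by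
        rw [div_pow, Real.sq_sqrt hN.le]
      rw [e2, e3]
      refine mul_le_mul_of_nonneg_left ?_ (by positivity)
      nlinarith [sq_nonneg (‖f w‖ - ‖monom k w‖ / √(monomNormSq Ω k)), sq_nonneg (‖f w‖),
        sq_nonneg (‖monom k w‖ / √(monomNormSq Ω k))]
    have h1 := hasSum_integral_of_summable_integral_norm hF hsum
    have h2 : ∫ w in Ω, ∑' k, F k w = ∫ w in Ω, f w * monomKernel Ω z w := by
      congr 1
      funext w
      rw [monomKernel, ← tsum_mul_left]
      congr 1
      funext k
      simp only [F]
      ring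
    have h3 : ∀ k, ∫ w in Ω, F k w = coeff f k * monom k z := by
      intro k
      have hN : (monomNormSq Ω k : ℂ) ≠ 0 := by exact_mod_cast (hΩ.monomNormSq_pos hz k).ne'
      simp only [F]
      rw [integral_const_mul, hΩ.integral_mul_conj_monom hf.1 k (hint k)]
      field_simp
    rw [h2] at h1
    -- Termwise integration has shown that the double Taylor series is summable; summing it first
    -- over the second index, then over the first, identifies its value with `f z`.
    have h4 := (h1.congr_terms h3).prod_fiberwise (g := fun m =>
      taylorCoeff (fun a => f (a, z.2)) m * z.1 ^ m) fun m => by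
        refine ((hΩ.hasSum_coeff_snd hf.1 hz m).mul_right (z.1 ^ m)).congr_terms fun n => ?_
        simp only [monom]
        ring
    exact (hΩ.hasSum_coeff_fst hf.1 hz).unique h4

end IsCompleteReinhardt

/-! ### Monomial norms on Ω_p and the power series of its kernel. -/

theorem isCompleteReinhardt_omegaDomain {p : ℝ} (hp : 0 < p) :
    IsCompleteReinhardt (OmegaDomain p) where
  isOpen := by
    have : Continuous fun z : ℂ × ℂ => ‖z.1‖ + ‖z.2‖ ^ (2 / p) :=
      continuous_fst.norm.add (continuous_snd.norm.rpow_const fun _ => Or.inr (by positivity))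
    exact isOpen_lt this continuous_const
  isBounded := by
    refine Metric.isBounded_ball.subset (t := Metric.ball 0 1) fun z hz => ?_
    have hz' : ‖z.1‖ + ‖z.2‖ ^ (2 / p) < 1 := hz
    have h1 : 0 ≤ ‖z.2‖ ^ (2 / p) := by positivity
    have h2 : ‖z.2‖ ^ (2 / p) < 1 := by have := norm_nonneg z.1; linarith
    rw [mem_ball_zero_iff, Prod.norm_def, max_lt_iff]
    refine ⟨by linarith, ?_⟩
    by_contra! h
    exact h2.not_ge (Real.one_le_rpow h (by positivity))
  mem_of_norm_le z hz w h1 h2 := by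
    have hz' : ‖z.1‖ + ‖z.2‖ ^ (2 / p) < 1 := hz
    change ‖w.1‖ + ‖w.2‖ ^ (2 / p) < 1
    have : ‖w.2‖ ^ (2 / p) ≤ ‖z.2‖ ^ (2 / p) := by gcongr
    linarith

theorem integral_fun_norm_complex (g : ℝ → ℝ) :
    ∫ z : ℂ, g ‖z‖ = 2 * Real.pi * ∫ y in Set.Ioi (0 : ℝ), y * g y := by
  rw [integral_fun_norm_addHaar volume g, Complex.finrank_real_complex]
  have : volume.real (Metric.ball (0 : ℂ) 1) = Real.pi := by
    simp [Measure.real, Complex.volume_ball]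
  rw [this]
  simp [mul_assoc]

/-- This is B(n + 1, α + 1). Since one argument is a positive integer, the Gamma quotient is a
finite product, the shape needed to recognise binomial series later. -/
theorem integral_pow_mul_one_sub_rpow {α : ℝ} (hα : 0 < α) (n : ℕ) :
    ∫ x in (0 : ℝ)..1, x ^ n * (1 - x) ^ α =
      n.factorial / ∏ j ∈ Finset.range (n + 1), (α + 1 + j) := by
  have h := Complex.betaIntegral_eval_nat_add_one_right (u := ((α + 1 : ℝ) : ℂ))
    (by rw [Complex.ofReal_re]; positivity) n
  rw [Complex.betaIntegral_symm, Complex.betaIntegral] at h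
  have e : ∫ x in (0 : ℝ)..1, (x : ℂ) ^ ((n : ℂ) + 1 - 1) * (1 - (x : ℂ)) ^ (((α + 1 : ℝ) : ℂ) - 1) =
      ((∫ x in (0 : ℝ)..1, x ^ n * (1 - x) ^ α : ℝ) : ℂ) := by
    rw [← intervalIntegral.integral_ofReal]
    refine intervalIntegral.integral_congr fun x hx => ?_
    rw [Set.uIcc_of_le zero_le_one] at hx
    simp only [add_sub_cancel_right, Complex.cpow_natCast]
    have : ((α + 1 : ℝ) : ℂ) - 1 = (α : ℂ) := by push_cast; ring
    rw [this]
    push_cast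
    rw [Complex.ofReal_cpow (by linarith [hx.2])]
    push_cast
    rfl
  rw [e] at h
  exact_mod_cast h

/-- The slice at |z₁| = `x` is the disc of radius (1 - x)^(p/2); polar coordinates raise this radius
to the power 2k₂ + 2. -/
theorem integral_slice {p : ℝ} (hp : 0 < p) (k : ℕ × ℕ) (x : ℝ) :
    ∫ b : ℂ, (if x + ‖b‖ ^ (2 / p) < 1 then (x ^ k.1 * ‖b‖ ^ k.2) ^ 2 else 0) =
      if x < 1 then Real.pi / (k.2 + 1) * (x ^ (2 * k.1) * (1 - x) ^ (p * (k.2 + 1))) else 0 := by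
  rw [integral_fun_norm_complex fun y => if x + y ^ (2 / p) < 1 then (x ^ k.1 * y ^ k.2) ^ 2 else 0]
  split_ifs with hx
  · have hx' : 0 < 1 - x := by linarith
    set R := (1 - x) ^ (p / 2) with hR
    have hR0 : 0 ≤ R := by positivity
    have h1 : ∀ y ∈ Set.Ioi (0 : ℝ),
        y * (if x + y ^ (2 / p) < 1 then (x ^ k.1 * y ^ k.2) ^ 2 else 0) =
        (Set.Iio R).indicator (fun y => x ^ (2 * k.1) * y ^ (2 * k.2 + 1)) y := by
      intro y hy
      have hy0 : 0 < y := hy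
      have hiff : x + y ^ (2 / p) < 1 ↔ y < R := by
        have e : R ^ (2 / p) = 1 - x := by
          rw [hR, ← Real.rpow_mul hx'.le]
          field_simp
          simp
        rw [← Real.rpow_lt_rpow_iff hy0.le hR0 (by positivity : 0 < 2 / p), e]
        constructor <;> intro h <;> linarith
      by_cases hyR : y < R
      · rw [if_pos (hiff.2 hyR), Set.indicator_of_mem (by exact hyR)]
        ring
      · rw [if_neg (fun h => hyR (hiff.1 h)), Set.indicator_of_notMem (by exact hyR), mul_zero]
    rw [setIntegral_congr_fun measurableSet_Ioi h1, setIntegral_indicator measurableSet_Iio,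
      Set.Ioi_inter_Iio, ← integral_Ioc_eq_integral_Ioo, ← intervalIntegral.integral_of_le hR0,
      intervalIntegral.integral_const_mul, integral_pow]
    have e : R ^ (2 * k.2 + 1 + 1) = (1 - x) ^ (p * (k.2 + 1)) := by
      rw [hR, ← Real.rpow_natCast, ← Real.rpow_mul hx'.le]
      congr 1
      push_cast
      ring
    rw [e]
    push_cast
    have : (k.2 : ℝ) + 1 ≠ 0 := by positivity
    field_simp
    simp
    ring
  · have h1 : ∀ y ∈ Set.Ioi (0 : ℝ),
        y * (if x + y ^ (2 / p) < 1 then (x ^ k.1 * y ^ k.2) ^ 2 else 0) = 0 := by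
      intro y hy
      have : 0 < y ^ (2 / p) := Real.rpow_pos_of_pos hy _
      rw [if_neg (by linarith), mul_zero]
    rw [setIntegral_congr_fun measurableSet_Ioi h1]
    simp

theorem monomNormSq_omegaDomain {p : ℝ} (hp : 0 < p) (k : ℕ × ℕ) :
    monomNormSq (OmegaDomain p) k = 2 * Real.pi ^ 2 / (k.2 + 1) *
      ((2 * k.1 + 1).factorial /
        ∏ j ∈ Finset.range (2 * k.1 + 1 + 1), (p * (k.2 + 1) + 1 + j)) := by
  have hΩ := isCompleteReinhardt_omegaDomain hp
  have hi := (integrable_indicator_iff hΩ.isOpen.measurableSet).2 (hΩ.integrableOn_norm_monom_sq k)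
  rw [monomNormSq, ← integral_indicator hΩ.isOpen.measurableSet]
  rw [Measure.volume_eq_prod] at hi ⊢
  rw [integral_prod _ hi]
  have e : ∀ a b : ℂ, (OmegaDomain p).indicator (fun w => ‖monom k w‖ ^ 2) (a, b) =
      if ‖a‖ + ‖b‖ ^ (2 / p) < 1 then (‖a‖ ^ k.1 * ‖b‖ ^ k.2) ^ 2 else 0 := by
    intro a b
    classical
    rw [Set.indicator_apply, norm_monom]
    rfl
  simp_rw [e, integral_slice hp k]
  rw [integral_fun_norm_complex fun x => if x < 1 then
    Real.pi / (k.2 + 1) * (x ^ (2 * k.1) * (1 - x) ^ (p * (k.2 + 1))) else 0]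
  have h1 : ∀ x ∈ Set.Ioi (0 : ℝ), x * (if x < 1 then
      Real.pi / (k.2 + 1) * (x ^ (2 * k.1) * (1 - x) ^ (p * (k.2 + 1))) else 0) =
      (Set.Iio 1).indicator (fun x => Real.pi / (k.2 + 1) *
        (x ^ (2 * k.1 + 1) * (1 - x) ^ (p * (k.2 + 1)))) x := by
    intro x _
    by_cases hx : x < 1
    · rw [if_pos hx, Set.indicator_of_mem (by exact hx)]
      ring
    · rw [if_neg hx, Set.indicator_of_notMem (by exact hx), mul_zero]
  rw [setIntegral_congr_fun measurableSet_Ioi h1, setIntegral_indicator measurableSet_Iio,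
    Set.Ioi_inter_Iio, ← integral_Ioc_eq_integral_Ioo, ← intervalIntegral.integral_of_le zero_le_one,
    intervalIntegral.integral_const_mul, integral_pow_mul_one_sub_rpow (by positivity)]
  ring

theorem isBergmanKernel_bergmanKernel {Ω : Set (ℂ × ℂ)} (hΩ : IsCompleteReinhardt Ω) :
    IsBergmanKernel Ω (bergmanKernel Ω) := by
  have h : ∃ K, IsBergmanKernel Ω K := ⟨_, hΩ.isBergmanKernel⟩
  rw [bergmanKernel, dif_pos h]
  exact h.choose_spec

/-- The Bergman kernel of `OmegaDomain p` as a power series. -/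
theorem hasSum_bergmanKernel {p : ℝ} (hp : 0 < p) {z w : ℂ × ℂ} (hz : z ∈ OmegaDomain p)
    (hw : w ∈ OmegaDomain p) :
    HasSum (fun k : ℕ × ℕ => ((k.2 + 1 : ℂ) *
      ((∏ j ∈ Finset.range (2 * k.1 + 1 + 1), ((p : ℂ) * (k.2 + 1) + 1 + j)) /
        (2 * k.1 + 1).factorial)) *
      ((z.1 * star w.1) ^ k.1 * (z.2 * star w.2) ^ k.2))
      (2 * Real.pi ^ 2 * bergmanKernel (OmegaDomain p) z w) := by
  have hΩ := isCompleteReinhardt_omegaDomain hp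
  rw [(isBergmanKernel_bergmanKernel hΩ).unique hΩ.isOpen hΩ.isBergmanKernel hz hw]
  refine ((hΩ.hasSum_monomKernel hz hw).mul_left (2 * Real.pi ^ 2 : ℂ)).congr_terms fun k => ?_
  have hpos : (∏ j ∈ Finset.range (2 * k.1 + 1 + 1), (p * (k.2 + 1) + 1 + j) : ℝ) ≠ 0 :=
    (Finset.prod_pos fun j _ => by positivity).ne'
  have hpos' : (∏ j ∈ Finset.range (2 * k.1 + 1 + 1), ((p : ℂ) * (k.2 + 1) + 1 + j)) ≠ 0 := by
    exact_mod_cast hpos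
  have hk : (k.2 : ℂ) + 1 ≠ 0 := by exact_mod_cast k.2.succ_ne_zero
  have hf : ((2 * k.1 + 1).factorial : ℂ) ≠ 0 := by exact_mod_cast Nat.factorial_ne_zero _
  have hpi : (Real.pi : ℂ) ≠ 0 := by simp [Real.pi_ne_zero]
  rw [monomNormSq_omegaDomain hp, monom, monom, star_mul', star_pow, star_pow, mul_pow, mul_pow]
  push_cast
  field_simp

/-! ### Binomial series and zeros on the axis z₂ = 0. -/

theorem ringChoose_add_sub_one (a : ℂ) (n : ℕ) :
    Ring.choose (a + n - 1) n = (∏ j ∈ Finset.range n, (a + j)) / n.factorial := by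
  have h := Ring.factorial_nsmul_multichoose_eq_ascPochhammer a n
  rw [Polynomial.ascPochhammer_smeval_eq_eval, nsmul_eq_mul] at h
  have h2 : (ascPochhammer ℂ n).eval a = ∏ j ∈ Finset.range n, (a + j) := by
    clear h
    induction n with
    | zero => simp
    | succ n ih => rw [ascPochhammer_succ_eval, Finset.prod_range_succ, ih]
  rw [← Ring.multichoose_eq, eq_div_iff (by exact_mod_cast Nat.factorial_ne_zero n), ← h2, ← h,
    mul_comm]

theorem hasSum_one_div_one_sub_cpow (a : ℂ) {s : ℂ} (hs : ‖s‖ < 1) :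
    HasSum (fun n : ℕ => (∏ j ∈ Finset.range n, (a + j)) / n.factorial * s ^ n)
      (1 / (1 - s) ^ a) := by
  have h := (Complex.one_div_one_sub_cpow_hasFPowerSeriesOnBall_zero a).hasSum (y := s)
    (by simpa [← ofReal_norm] using hs)
  rw [zero_add] at h
  refine h.congr_terms fun n => ?_
  simp [← ringChoose_add_sub_one, mul_comm]

section FirstAxis

variable {p : ℝ} {z₁ w₁ : ℂ}

theorem mem_omegaDomain_fst (hp : 0 < p) : (z₁, 0) ∈ OmegaDomain p ↔ ‖z₁‖ < 1 := by
  change ‖z₁‖ + ‖(0 : ℂ)‖ ^ (2 / p) < 1 ↔ _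
  rw [norm_zero, Real.zero_rpow (by positivity), add_zero]

theorem hasSum_bergmanKernel_fst (hp : 0 < p) (hz : ‖z₁‖ < 1) (hw : ‖w₁‖ < 1) :
    HasSum (fun m : ℕ => (∏ j ∈ Finset.range (2 * m + 1 + 1), ((p : ℂ) + 1 + j)) /
        (2 * m + 1).factorial * (z₁ * star w₁) ^ m)
      (2 * Real.pi ^ 2 * bergmanKernel (OmegaDomain p) (z₁, 0) (w₁, 0)) := by
  have h := hasSum_bergmanKernel hp ((mem_omegaDomain_fst hp).2 hz) ((mem_omegaDomain_fst hp).2 hw)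
  have hinj : Function.Injective fun m : ℕ => (m, 0) := fun a b h => (Prod.mk.inj h).1
  rw [← hinj.hasSum_iff] at h
  · refine h.congr_terms fun m => ?_
    simp
  · rintro ⟨m, n⟩ hn
    have : n ≠ 0 := fun h => hn ⟨m, by rw [h]⟩
    simp [this]

theorem bergmanKernel_fst_ne_zero (hp : 0 < p) (hz : ‖z₁‖ < 1) (hw : ‖w₁‖ < 1)
    (h : z₁ * star w₁ = 0) : bergmanKernel (OmegaDomain p) (z₁, 0) (w₁, 0) ≠ 0 := by
  intro h0
  have h1 := hasSum_bergmanKernel_fst hp hz hw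
  rw [h, h0, mul_zero] at h1
  have h2 := h1.unique (hasSum_single 0 fun m hm => by rw [zero_pow hm, mul_zero])
  simp [Finset.prod_range_succ] at h2
  have e1 : (p : ℂ) + 1 ≠ 0 := by exact_mod_cast (by positivity : p + 1 ≠ 0)
  have e2 : (p : ℂ) + 1 + 1 ≠ 0 := by exact_mod_cast (by positivity : p + 1 + 1 ≠ 0)
  tauto

/-- Taking p + 1 out of the product in the coefficient leaves the coefficient of s^(2m+1) in (1 -
s)^(-(p+2)), so the kernel comes from the odd part of that function. The relation carries no
information at s = 0, which `bergmanKernel_fst_ne_zero` covers. -/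
theorem bergmanKernel_fst_eq (hp : 0 < p) (hz : ‖z₁‖ < 1) (hw : ‖w₁‖ < 1) {s : ℂ}
    (hs : s ^ 2 = z₁ * star w₁) (hs1 : ‖s‖ < 1) :
    2 * s * (2 * Real.pi ^ 2 * bergmanKernel (OmegaDomain p) (z₁, 0) (w₁, 0)) =
      (p + 1) * (1 / (1 - s) ^ ((p + 2 : ℝ) : ℂ) - 1 / (1 + s) ^ ((p + 2 : ℝ) : ℂ)) := by
  have h1 := hasSum_one_div_one_sub_cpow ((p + 2 : ℝ) : ℂ) hs1
  have h2 := hasSum_one_div_one_sub_cpow ((p + 2 : ℝ) : ℂ) (s := -s) (by rwa [norm_neg])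
  rw [sub_neg_eq_add] at h2
  have h3 := h1.sub h2
  have hinj : Function.Injective fun m : ℕ => 2 * m + 1 := fun a b h => by simpa using h
  rw [← hinj.hasSum_iff] at h3
  · refine ((hasSum_bergmanKernel_fst hp hz hw).mul_left (2 * s)).unique
      ((h3.mul_left ((p : ℂ) + 1)).congr_terms fun m => ?_)
    rw [Finset.prod_range_succ', ← hs, ← pow_mul, Function.comp, Odd.neg_pow ⟨m, rfl⟩, pow_succ]
    push_cast
    have : ∀ j : ℕ, (p : ℂ) + 1 + (j + 1) = p + 2 + j := fun j => by ring
    simp_rw [this]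
    ring
  · intro n hn
    have : Even n := by
      by_contra h
      obtain ⟨m, hm⟩ := Nat.not_even_iff_odd.1 h
      exact hn ⟨m, hm.symm⟩
    simp [this.neg_pow]

/-- The bases are conjugate, with arguments ± arctan y, so their principal logarithms differ by 2i
arctan y; the powers agree when q times this lies in 2πiℤ. -/
theorem one_add_mul_I_cpow_eq_iff {q y : ℝ} :
    (1 + y * Complex.I) ^ (q : ℂ) = (1 - y * Complex.I) ^ (q : ℂ) ↔
      ∃ n : ℤ, q * Real.arctan y = Real.pi * n := by
  have h1 : (1 + y * Complex.I : ℂ) ≠ 0 := fun h => by simpa using congrArg Complex.re h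
  have h2 : (1 - y * Complex.I : ℂ) ≠ 0 := fun h => by simpa using congrArg Complex.re h
  have hlt : |Complex.arg (1 + y * Complex.I)| < Real.pi / 2 :=
    Complex.abs_arg_lt_pi_div_two_iff.2 (Or.inl (by simp))
  have harg : Complex.arg (1 + y * Complex.I) = Real.arctan y := by
    have := Complex.tan_arg (1 + y * Complex.I)
    rw [← Real.arctan_tan (abs_lt.1 hlt).1 (abs_lt.1 hlt).2, this]
    simp
  have hconj : (1 - y * Complex.I : ℂ) = starRingEnd ℂ (1 + y * Complex.I) := by
    simp [sub_eq_add_neg]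
  have hlog : Complex.log (1 + y * Complex.I) =
      Complex.log (1 - y * Complex.I) + 2 * Real.arctan y * Complex.I := by
    rw [hconj, Complex.log_conj _ (fun h => by
      have := (abs_lt.1 hlt).2; rw [h] at this; linarith [Real.pi_pos])]
    have := Complex.sub_conj (Complex.log (1 + y * Complex.I))
    rw [Complex.log_im, harg] at this
    rw [Complex.ofReal_mul, Complex.ofReal_ofNat] at this
    rw [← this]
    ring
  rw [Complex.cpow_def_of_ne_zero h1, Complex.cpow_def_of_ne_zero h2,
    Complex.exp_eq_exp_iff_exists_int, hlog]
  refine exists_congr fun n => ?_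
  rw [add_mul, add_right_inj]
  constructor
  · intro h
    have h3 : ((q * Real.arctan y : ℝ) : ℂ) = ((Real.pi * n : ℝ) : ℂ) := by
      have : (2 * Complex.I : ℂ) ≠ 0 := by simp
      refine mul_left_cancel₀ this ?_
      push_cast [-Complex.ofReal_arctan]
      linear_combination h
    exact_mod_cast h3
  · intro h
    have h3 : ((q * Real.arctan y : ℝ) : ℂ) = ((Real.pi * n : ℝ) : ℂ) := by rw [h]
    push_cast [-Complex.ofReal_arctan] at h3
    linear_combination 2 * Complex.I * h3

theorem exists_bergmanKernel_fst_eq_zero_iff (hp : 0 < p) :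
    (∃ z₁ w₁ : ℂ, (z₁, 0) ∈ OmegaDomain p ∧ (w₁, 0) ∈ OmegaDomain p ∧
      bergmanKernel (OmegaDomain p) (z₁, 0) (w₁, 0) = 0) ↔ 2 < p := by
  simp_rw [mem_omegaDomain_fst hp]
  have hp1 : (p : ℂ) + 1 ≠ 0 := by exact_mod_cast (by positivity : p + 1 ≠ 0)
  constructor
  · rintro ⟨z₁, w₁, hz, hw, h0⟩
    by_contra! hp2
    obtain ⟨s, hs⟩ := IsAlgClosed.exists_pow_nat_eq (z₁ * star w₁) zero_lt_two
    have hs1 : ‖s‖ < 1 := by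
      have : ‖s‖ ^ 2 < 1 := by
        rw [← norm_pow, hs, norm_mul, norm_star]
        nlinarith [norm_nonneg z₁, norm_nonneg w₁]
      nlinarith [norm_nonneg s]
    have hs0 : s ≠ 0 := fun h =>
      bergmanKernel_fst_ne_zero hp hz hw (by rw [← hs, h]; simp) h0
    have h1 := bergmanKernel_fst_eq hp hz hw hs hs1
    rw [h0, mul_zero, mul_zero, zero_eq_mul, or_iff_right hp1, sub_eq_zero, one_div, one_div,
      inv_inj] at h1
    have hre : s.re = 0 := by
      have h2 : ‖1 - s‖ = ‖1 + s‖ := by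
        have := congrArg norm h1
        rw [Complex.norm_cpow_real, Complex.norm_cpow_real] at this
        exact (Real.rpow_left_inj (norm_nonneg _) (norm_nonneg _) (by positivity)).1 this
      have h3 : Complex.normSq (1 - s) = Complex.normSq (1 + s) := by
        rw [Complex.normSq_eq_norm_sq, Complex.normSq_eq_norm_sq, h2]
      simp [Complex.normSq_apply] at h3
      linarith
    have hsy : s = s.im * Complex.I := by
      conv_lhs => rw [← Complex.re_add_im s, hre]
      simp
    rw [hsy] at h1
    obtain ⟨n, hn⟩ := one_add_mul_I_cpow_eq_iff.1 h1.symm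
    have him : |s.im| < 1 := (Complex.abs_im_le_norm s).trans_lt hs1
    have ha1 : Real.arctan s.im < Real.pi / 4 := by
      rw [← Real.arctan_one]
      exact Real.arctan_strictMono (abs_lt.1 him).2
    have ha2 : -(Real.pi / 4) < Real.arctan s.im := by
      rw [← Real.arctan_one, ← Real.arctan_neg]
      exact Real.arctan_strictMono (abs_lt.1 him).1
    have hpi := Real.pi_pos
    -- Here p + 2 ≤ 4 and |arctan| < π/4, so |πn| < π.
    have hn1 : (n : ℝ) < 1 := by
      by_contra! h
      nlinarith
    have hn2 : (-1 : ℝ) < n := by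
      by_contra! h
      nlinarith
    have hn0 : n = 0 := by
      have h3 : n < 1 := by exact_mod_cast hn1
      have h4 : -1 < n := by exact_mod_cast hn2
      omega
    rw [hn0, Int.cast_zero, mul_zero, mul_eq_zero, or_iff_right (by positivity),
      Real.arctan_eq_zero_iff] at hn
    exact hs0 (Complex.ext hre hn)
  · intro hp2
    have hpi := Real.pi_pos
    have hθ : Real.pi / (p + 2) < Real.pi / 4 := by
      gcongr
      linarith
    have hθ0 : 0 < Real.pi / (p + 2) := by positivity
    set y := Real.tan (Real.pi / (p + 2)) with hy
    have hy0 : 0 < y := Real.tan_pos_of_pos_of_lt_pi_div_two hθ0 (by linarith)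
    have hat : Real.arctan y = Real.pi / (p + 2) := Real.arctan_tan (by linarith) (by linarith)
    have hy1 : y < 1 := by
      rw [← Real.arctan_strictMono.lt_iff_lt, hat, Real.arctan_one]
      exact hθ
    have hyn : ‖(y : ℂ)‖ < 1 := by rwa [Complex.norm_real, Real.norm_of_nonneg hy0.le]
    -- The product z₁w̄₁ is -y² = (iy)², and (p + 2) arctan y = π is the first nonzero solution; p >
    -- 2 is what makes y < 1.
    refine ⟨y, -y, hyn, by rwa [norm_neg], ?_⟩
    have h1 := bergmanKernel_fst_eq (s := y * Complex.I) hp hyn (by rwa [norm_neg])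
      (by simp [mul_pow]; ring) (by simpa using hyn)
    rw [one_add_mul_I_cpow_eq_iff.2 ⟨1, by rw [hat]; field_simp; simp⟩, sub_self, mul_zero] at h1
    have hI : (2 * (y * Complex.I) : ℂ) ≠ 0 := by simp [hy0.ne']
    have hpic : (2 * Real.pi ^ 2 : ℂ) ≠ 0 := by simp [hpi.ne']
    exact (mul_eq_zero.1 ((mul_eq_zero.1 h1).resolve_left hI)).resolve_left hpic

end FirstAxis

/-! ### Zeros on the axis z₁ = 0. -/

section SecondAxis

variable {p : ℝ} {z₂ w₂ : ℂ}

theorem mem_omegaDomain_snd (hp : 0 < p) : (0, z₂) ∈ OmegaDomain p ↔ ‖z₂‖ < 1 := by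
  change ‖(0 : ℂ)‖ + ‖z₂‖ ^ (2 / p) < 1 ↔ _
  rw [norm_zero, zero_add]
  refine ⟨fun h => ?_, fun h => Real.rpow_lt_one (norm_nonneg _) h (by positivity)⟩
  by_contra! h1
  exact h.not_ge (Real.one_le_rpow h1 (by positivity))

/-- The n-th coefficient (n+1)(p(n+1)+1)(p(n+1)+2) is expanded in the binomials C(n+3,3), C(n+2,2),
C(n+1,1), whose generating functions are negative powers of 1 - μ. -/
theorem bergmanKernel_snd_eq (hp : 0 < p) (hz : ‖z₂‖ < 1) (hw : ‖w₂‖ < 1) :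
    2 * Real.pi ^ 2 * bergmanKernel (OmegaDomain p) (0, z₂) (0, w₂) =
      6 * p ^ 2 / (1 - z₂ * star w₂) ^ 4 + (6 * p - 6 * p ^ 2) / (1 - z₂ * star w₂) ^ 3 +
        (p ^ 2 - 3 * p + 2) / (1 - z₂ * star w₂) ^ 2 := by
  have h := hasSum_bergmanKernel hp ((mem_omegaDomain_snd hp).2 hz) ((mem_omegaDomain_snd hp).2 hw)
  have hinj : Function.Injective fun n : ℕ => (0, n) := fun a b h => (Prod.mk.inj h).2
  rw [← hinj.hasSum_iff] at h
  · have hμ : ‖z₂ * star w₂‖ < 1 := by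
      rw [norm_mul, norm_star]
      nlinarith [norm_nonneg z₂, norm_nonneg w₂]
    have h3 := (hasSum_choose_mul_geometric_of_norm_lt_one 3 hμ).mul_left (6 * (p : ℂ) ^ 2)
    have h2 := (hasSum_choose_mul_geometric_of_norm_lt_one 2 hμ).mul_left
      (6 * (p : ℂ) - 6 * p ^ 2)
    have h1 := (hasSum_choose_mul_geometric_of_norm_lt_one 1 hμ).mul_left
      ((p : ℂ) ^ 2 - 3 * p + 2)
    rw [h.unique (((h3.add h2).add h1).congr_terms fun n => ?_)]
    · simp [div_eq_mul_inv]
    · have c2 : ((n + 2).choose 2 : ℂ) = (n + 2) * (n + 1) / 2 := by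
        rw [Nat.cast_choose_two]
        push_cast
        ring
      have c3 : ((n + 3).choose 3 : ℂ) = (n + 3) * ((n + 2) * (n + 1) / 2) / 3 := by
        have := Nat.add_one_mul_choose_eq (n + 2) 2
        have : ((n + 2 + 1 : ℕ) : ℂ) * ((n + 2).choose 2 : ℂ) = ((n + 3).choose 3 : ℂ) * 3 := by
          exact_mod_cast this
        rw [← c2]
        push_cast at this
        linear_combination -this / 3
      simp only [c2, c3, Nat.choose_one_right, Function.comp]
      simp [Finset.prod_range_succ]
      ring
  · rintro ⟨m, n⟩ hn
    have : m ≠ 0 := fun h => hn ⟨n, by rw [h]⟩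
    simp [this]

theorem exists_bergmanKernel_snd_eq_zero (hp : 2 < p) :
    ∃ z₂ w₂ : ℂ, (0, z₂) ∈ OmegaDomain p ∧ (0, w₂) ∈ OmegaDomain p ∧
      bergmanKernel (OmegaDomain p) (0, z₂) (0, w₂) = 0 := by
  have hp0 : 0 < p := by linarith
  -- The kernel times x⁴, up to a constant, at x = 1 - μ. Here g(1) = p² + 3p + 2 > 0 and g(2) = 8 -
  -- 2p² < 0; a root x in (1, 2) is reached with μ = -(x - 1).
  let g : ℝ → ℝ := fun x => 6 * p ^ 2 + (6 * p - 6 * p ^ 2) * x + (p ^ 2 - 3 * p + 2) * x ^ 2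
  obtain ⟨x, ⟨hx1, hx2⟩, hgx⟩ : (0 : ℝ) ∈ g '' Set.Ioo 1 2 :=
    intermediate_value_Ioo' one_le_two (by fun_prop : Continuous g).continuousOn
      ⟨by simp only [g]; nlinarith, by simp only [g]; nlinarith⟩
  have hy : ‖(√(x - 1) : ℂ)‖ < 1 := by
    rw [Complex.norm_real, Real.norm_of_nonneg (Real.sqrt_nonneg _), Real.sqrt_lt' one_pos]
    linarith
  simp_rw [mem_omegaDomain_snd hp0]
  refine ⟨√(x - 1), -√(x - 1), hy, by rwa [norm_neg], ?_⟩
  have h := bergmanKernel_snd_eq (w₂ := -(√(x - 1) : ℂ)) hp0 hy (by rwa [norm_neg])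
  have e : 1 - (√(x - 1) : ℂ) * star (-(√(x - 1) : ℂ)) = x := by
    have : ((√(x - 1) : ℝ) : ℂ) * (√(x - 1) : ℝ) = ((x - 1 : ℝ) : ℂ) := by
      rw [← Complex.ofReal_mul, Real.mul_self_sqrt (by linarith)]
    simp [this]
  have hx0 : (x : ℂ) ≠ 0 := by exact_mod_cast (by linarith : x ≠ 0)
  have hgx' : (6 * p ^ 2 + (6 * p - 6 * p ^ 2) * x + (p ^ 2 - 3 * p + 2) * x ^ 2 : ℂ) = 0 := by
    exact_mod_cast hgx
  have e2 : (6 * p ^ 2 / (x : ℂ) ^ 4 + (6 * p - 6 * p ^ 2) / (x : ℂ) ^ 3 +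
      (p ^ 2 - 3 * p + 2) / (x : ℂ) ^ 2) = 0 := by
    rw [← mul_zero ((x : ℂ) ^ 4)⁻¹, ← hgx']
    field_simp
  rw [e, e2] at h
  have hpic : (2 * Real.pi ^ 2 : ℂ) ≠ 0 := by simp [Real.pi_ne_zero]
  exact (mul_eq_zero.1 h).resolve_left hpic

end SecondAxis

/-! ### Closed form of the kernel for p = 2. -/

theorem sum_antidiagonal_mul_choose {R : Type*} [CommRing R] (s t : R) (N : ℕ) :
    ∑ k ∈ Finset.HasAntidiagonal.antidiagonal N,
      ((k.1 + k.2 + 2) * (k.1 + k.2 + 1) : R) * ((k.1 + k.2).choose k.1 : R) * (s ^ k.1 * t ^ k.2) =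
      (N + 2) * (N + 1) * (s + t) ^ N := by
  rw [(Commute.all s t).add_pow', Finset.mul_sum]
  refine Finset.sum_congr rfl fun k hk => ?_
  rw [← Finset.HasAntidiagonal.mem_antidiagonal.1 hk, nsmul_eq_mul]
  push_cast
  ring

theorem hasSum_two_div_one_sub_cube {x : ℂ} (hx : ‖x‖ < 1) :
    HasSum (fun N : ℕ => ((N + 2) * (N + 1) : ℂ) * x ^ N) (2 / (1 - x) ^ 3) := by
  have h := (hasSum_choose_mul_geometric_of_norm_lt_one 2 hx).mul_left 2
  rw [mul_one_div] at h
  refine h.congr_terms fun n => ?_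
  rw [Nat.cast_choose_two]
  push_cast
  ring

/-- The expansion of `2 / (1 - s - t) ^ 3` in powers of `s` and `t`. -/
theorem hasSum_two_div_one_sub_sub_cube {s t : ℂ} (h : ‖s‖ + ‖t‖ < 1) :
    HasSum (fun k : ℕ × ℕ => ((k.1 + k.2 + 2) * (k.1 + k.2 + 1) : ℂ) *
      ((k.1 + k.2).choose k.1 : ℂ) * (s ^ k.1 * t ^ k.2)) (2 / (1 - (s + t)) ^ 3) := by
  set F : ℕ × ℕ → ℂ := fun k => ((k.1 + k.2 + 2) * (k.1 + k.2 + 1) : ℂ) *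
      ((k.1 + k.2).choose k.1 : ℂ) * (s ^ k.1 * t ^ k.2) with hF
  let e := Finset.HasAntidiagonal.sigmaAntidiagonalEquivProd (A := ℕ)
  have hin : ∀ N, HasSum (fun k : Finset.HasAntidiagonal.antidiagonal N => (F ∘ e) ⟨N, k⟩)
      (((N + 2) * (N + 1) : ℂ) * (s + t) ^ N) := by
    intro N
    rw [← sum_antidiagonal_mul_choose s t N]
    exact Finset.hasSum (Finset.HasAntidiagonal.antidiagonal N) F
  -- The coefficients are nonnegative, so the same identity at ‖s‖, ‖t‖ gives absolute summability.
  have hin' : ∀ N, HasSum (fun k : Finset.HasAntidiagonal.antidiagonal N => ‖(F ∘ e) ⟨N, k⟩‖)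
      (((N + 2) * (N + 1) : ℝ) * (‖s‖ + ‖t‖) ^ N) := by
    intro N
    rw [← sum_antidiagonal_mul_choose ‖s‖ ‖t‖ N]
    have h1 : ∀ k : ℕ × ℕ, ‖F k‖ = ((k.1 + k.2 + 2) * (k.1 + k.2 + 1) : ℝ) *
        ((k.1 + k.2).choose k.1 : ℝ) * (‖s‖ ^ k.1 * ‖t‖ ^ k.2) := by
      intro k
      simp only [hF, norm_mul, norm_pow, Complex.norm_natCast]
      congr 3
      · exact_mod_cast Complex.norm_natCast (k.1 + k.2 + 2)
      · exact_mod_cast Complex.norm_natCast (k.1 + k.2 + 1)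
    simp_rw [← h1]
    exact Finset.hasSum (Finset.HasAntidiagonal.antidiagonal N) fun k => ‖F k‖
  have hsumm : Summable (F ∘ e) := by
    refine Summable.of_norm ((summable_sigma_of_nonneg fun _ => norm_nonneg _).2
      ⟨fun N => (hin' N).summable, ?_⟩)
    simp_rw [(hin' _).tsum_eq]
    have hc := (hasSum_two_div_one_sub_cube (x := ((‖s‖ + ‖t‖ : ℝ) : ℂ)) (by
      rw [Complex.norm_real, Real.norm_of_nonneg (by positivity)]; exact h)).summable
    exact_mod_cast hc
  have hst : ‖s + t‖ < 1 := (norm_add_le s t).trans_lt h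
  rw [← e.hasSum_iff]
  have h3 := hsumm.hasSum
  rwa [(h3.sigma hin).unique (hasSum_two_div_one_sub_cube hst)] at h3

/-- The coefficients of the Bergman kernel for `p = 2`. -/
noncomputable def kernelCoeffTwo (k : ℕ × ℕ) : ℂ :=
  (k.2 + 1 : ℂ) * ((∏ j ∈ Finset.range (2 * k.1 + 1 + 1), (((2 : ℝ) : ℂ) * (k.2 + 1) + 1 + j)) /
    (2 * k.1 + 1).factorial)

/-- For p = 2 the product is the factorial quotient (2m+2n+4)!/(2n+2)!. The right side is the
coefficient of s^(2m+1) t^(2n+1) in 2/(1 - s - t)³. -/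
theorem kernelCoeffTwo_eq (m n : ℕ) :
    2 * kernelCoeffTwo (m, n) = (((2 * m + 1 : ℕ) + (2 * n + 1 : ℕ) + 2) *
      ((2 * m + 1 : ℕ) + (2 * n + 1 : ℕ) + 1) : ℂ) *
        (((2 * m + 1) + (2 * n + 1)).choose (2 * m + 1) : ℂ) := by
  have hprod : ∀ K : ℕ, ((2 * n + 2).factorial : ℂ) *
      ∏ j ∈ Finset.range K, (((2 : ℝ) : ℂ) * (n + 1) + 1 + j) = (2 * n + 2 + K).factorial := by
    intro K
    induction K with
    | zero => simp
    | succ K ih =>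
      rw [Finset.prod_range_succ, ← mul_assoc, ih, ← add_assoc, Nat.factorial_succ]
      push_cast
      ring
  have h1 := hprod (2 * m + 1 + 1)
  have h2 : ((2 * m + 1 + (2 * n + 1)).choose (2 * m + 1) : ℂ) * (2 * m + 1).factorial *
      (2 * n + 1).factorial = (2 * m + 1 + (2 * n + 1)).factorial := by
    rw [Nat.choose_symm_add]
    exact_mod_cast Nat.add_choose_mul_factorial_mul_factorial (2 * m + 1) (2 * n + 1)
  have h3 : ((2 * n + 2 + (2 * m + 1 + 1)).factorial : ℂ) =
      (2 * m + 1 + (2 * n + 1) + 2) * ((2 * m + 1 + (2 * n + 1) + 1) *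
        (2 * m + 1 + (2 * n + 1)).factorial) := by
    rw [show 2 * n + 2 + (2 * m + 1 + 1) = (2 * m + 1 + (2 * n + 1)) + 1 + 1 by ring,
      Nat.factorial_succ, Nat.factorial_succ]
    push_cast
    ring
  have h4 : ((2 * n + 2).factorial : ℂ) = (2 * n + 2) * (2 * n + 1).factorial := by
    rw [Nat.factorial_succ]
    push_cast
    ring
  have f1 : ((2 * m + 1).factorial : ℂ) ≠ 0 := by exact_mod_cast Nat.factorial_ne_zero _
  have f2 : ((2 * n + 1).factorial : ℂ) ≠ 0 := by exact_mod_cast Nat.factorial_ne_zero _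
  rw [h3, ← h2, h4] at h1
  simp only [kernelCoeffTwo]
  rw [← mul_assoc, mul_div_assoc', div_eq_iff f1]
  refine mul_right_cancel₀ f2 ?_
  push_cast
  linear_combination h1

/-- The closed form of the Bergman kernel for `p = 2`, up to the factor `2 * π ^ 2`. -/
noncomputable def kernelTwo (ν μ : ℂ) : ℂ :=
  4 * (3 * (1 - ν - μ) ^ 2 * (1 + ν + μ) + 4 * (ν * μ) * (5 - 3 * ν - 3 * μ)) /
    ((1 - ν - μ) ^ 2 - 4 * (ν * μ)) ^ 3

theorem one_sub_ne_zero_of_norm_lt {x : ℂ} (hx : ‖x‖ < 1) : 1 - x ≠ 0 := fun h => by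
  rw [← sub_eq_zero.1 h, norm_one] at hx
  exact lt_irrefl _ hx

theorem kernelTwo_denominator_ne_zero {s t : ℂ} (h : ‖s‖ + ‖t‖ < 1) :
    (1 - s ^ 2 - t ^ 2) ^ 2 - 4 * (s ^ 2 * t ^ 2) ≠ 0 := by
  have e : (1 - s ^ 2 - t ^ 2) ^ 2 - 4 * (s ^ 2 * t ^ 2) = (1 - (s + t) ^ 2) * (1 - (s - t) ^ 2) := by
    ring
  rw [e]
  refine mul_ne_zero (one_sub_ne_zero_of_norm_lt ?_) (one_sub_ne_zero_of_norm_lt ?_)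
  · rw [norm_pow]
    exact pow_lt_one₀ (norm_nonneg _) ((norm_add_le s t).trans_lt h) two_ne_zero
  · rw [norm_pow]
    exact pow_lt_one₀ (norm_nonneg _) ((norm_sub_le s t).trans_lt h) two_ne_zero

theorem hasSum_kernelTwo_of_ne_zero {s t : ℂ} (h : ‖s‖ + ‖t‖ < 1) (hs : s ≠ 0) (ht : t ≠ 0) :
    HasSum (fun k : ℕ × ℕ => kernelCoeffTwo k * ((s ^ 2) ^ k.1 * (t ^ 2) ^ k.2))
      (kernelTwo (s ^ 2) (t ^ 2)) := by
  have h1 := hasSum_two_div_one_sub_sub_cube h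
  have h2 := hasSum_two_div_one_sub_sub_cube (s := -s) (t := t) (by rwa [norm_neg])
  have h3 := hasSum_two_div_one_sub_sub_cube (s := s) (t := -t) (by rwa [norm_neg])
  have h4 := hasSum_two_div_one_sub_sub_cube (s := -s) (t := -t) (by rwa [norm_neg, norm_neg])
  -- The signed sum over (±s, ±t) keeps only terms odd in both variables, each four times; with the
  -- 2 of `kernelCoeffTwo_eq` this explains the divisor 8st.
  have hsum := ((h1.sub h2).sub h3).add h4
  have hinj : Function.Injective fun k : ℕ × ℕ => (2 * k.1 + 1, 2 * k.2 + 1) := by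
    rintro ⟨a, b⟩ ⟨c, d⟩ h
    simp only [Prod.mk.injEq] at h ⊢
    omega
  rw [← hinj.hasSum_iff] at hsum
  · have h5 := hsum.mul_left (8 * s * t)⁻¹
    have d1 : 1 - (s + t) ≠ 0 := one_sub_ne_zero_of_norm_lt ((norm_add_le _ _).trans_lt h)
    have d2 : 1 - (-s + t) ≠ 0 := one_sub_ne_zero_of_norm_lt
      ((norm_add_le _ _).trans_lt (by rwa [norm_neg]))
    have d3 : 1 - (s + -t) ≠ 0 := one_sub_ne_zero_of_norm_lt
      ((norm_add_le _ _).trans_lt (by rwa [norm_neg]))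
    have d4 : 1 - (-s + -t) ≠ 0 := one_sub_ne_zero_of_norm_lt
      ((norm_add_le _ _).trans_lt (by rwa [norm_neg, norm_neg]))
    have e : (8 * s * t)⁻¹ * (2 / (1 - (s + t)) ^ 3 - 2 / (1 - (-s + t)) ^ 3 -
        2 / (1 - (s + -t)) ^ 3 + 2 / (1 - (-s + -t)) ^ 3) = kernelTwo (s ^ 2) (t ^ 2) := by
      have hden : (1 - s ^ 2 - t ^ 2) ^ 2 - 4 * (s ^ 2 * t ^ 2) =
          (1 - (s + t)) * (1 - (-s + t)) * (1 - (s + -t)) * (1 - (-s + -t)) := by ring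
      rw [kernelTwo, hden]
      field_simp
      ring
    rw [e] at h5
    refine h5.congr_terms fun k => ?_
    obtain ⟨m, n⟩ := k
    have hst : (8 * s * t) ≠ 0 := by simp [hs, ht]
    rw [inv_mul_eq_iff_eq_mul₀ hst]
    have hc := kernelCoeffTwo_eq m n
    simp only [Function.comp, Odd.neg_pow ⟨m, rfl⟩, Odd.neg_pow ⟨n, rfl⟩]
    rw [← hc]
    ring
  · rintro ⟨a, b⟩ hab
    have hor : Even a ∨ Even b := by
      by_contra! hcon
      obtain ⟨m, hm⟩ := Nat.not_even_iff_odd.1 hcon.1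
      obtain ⟨n, hn⟩ := Nat.not_even_iff_odd.1 hcon.2
      exact hab ⟨(m, n), by rw [hm, hn]⟩
    rcases hor with hab | hab
    · simp only [hab.neg_pow]
      ring
    · simp only [hab.neg_pow]
      ring

/-- Removes the division by st: both variables are shifted by a small ε ≠ 0, and ε → 0 by dominated
convergence. The dominating series is the one at the radii `a`, `b`, which exceed ‖s‖, ‖t‖ and still
have sum below 1. -/
theorem hasSum_kernelTwo {s t : ℂ} (h : ‖s‖ + ‖t‖ < 1) :
    HasSum (fun k : ℕ × ℕ => kernelCoeffTwo k * ((s ^ 2) ^ k.1 * (t ^ 2) ^ k.2))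
      (kernelTwo (s ^ 2) (t ^ 2)) := by
  set r : ℝ := (1 - ‖s‖ - ‖t‖) / 4 with hr
  have hr0 : 0 < r := by rw [hr]; linarith
  set a : ℝ := ‖s‖ + r with ha
  set b : ℝ := ‖t‖ + r with hb
  have ha0 : 0 < a := by positivity
  have hb0 : 0 < b := by positivity
  have hna : ‖(a : ℂ)‖ = a := by rw [Complex.norm_real, Real.norm_of_nonneg ha0.le]
  have hnb : ‖(b : ℂ)‖ = b := by rw [Complex.norm_real, Real.norm_of_nonneg hb0.le]
  have hbound := (hasSum_kernelTwo_of_ne_zero (s := a) (t := b) (by rw [hna, hnb]; linarith)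
    (by exact_mod_cast ha0.ne') (by exact_mod_cast hb0.ne')).summable.norm
  have hle : ∀ s' t' : ℂ, ‖s'‖ ≤ a → ‖t'‖ ≤ b → ∀ k : ℕ × ℕ,
      ‖kernelCoeffTwo k * ((s' ^ 2) ^ k.1 * (t' ^ 2) ^ k.2)‖ ≤
        ‖kernelCoeffTwo k * (((a : ℂ) ^ 2) ^ k.1 * ((b : ℂ) ^ 2) ^ k.2)‖ := by
    intro s' t' h1 h2 k
    simp only [norm_mul, norm_pow, hna, hnb]
    gcongr
  have hsumm : Summable fun k : ℕ × ℕ => kernelCoeffTwo k * ((s ^ 2) ^ k.1 * (t ^ 2) ^ k.2) :=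
    Summable.of_norm_bounded hbound (hle s t (by linarith) (by linarith))
  have hlim : Tendsto (fun ε : ℂ => ∑' k : ℕ × ℕ,
      kernelCoeffTwo k * (((s + ε) ^ 2) ^ k.1 * ((t + ε) ^ 2) ^ k.2)) (𝓝[≠] 0)
      (𝓝 (∑' k : ℕ × ℕ, kernelCoeffTwo k * ((s ^ 2) ^ k.1 * (t ^ 2) ^ k.2))) := by
    refine tendsto_tsum_of_dominated_convergence hbound (fun k => ?_) ?_
    · have : Continuous fun ε : ℂ =>
          kernelCoeffTwo k * (((s + ε) ^ 2) ^ k.1 * ((t + ε) ^ 2) ^ k.2) := by fun_prop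
      simpa using (this.tendsto 0).mono_left nhdsWithin_le_nhds
    · filter_upwards [nhdsWithin_le_nhds (Metric.closedBall_mem_nhds (0 : ℂ) hr0)] with ε hε
      have hε' : ‖ε‖ ≤ r := by simpa using hε
      exact hle _ _ ((norm_add_le _ _).trans (by linarith)) ((norm_add_le _ _).trans (by linarith))
  have hlim2 : Tendsto (fun ε : ℂ => kernelTwo ((s + ε) ^ 2) ((t + ε) ^ 2)) (𝓝[≠] 0)
      (𝓝 (kernelTwo (s ^ 2) (t ^ 2))) := by
    have hd : ((1 - (s + 0) ^ 2 - (t + 0) ^ 2) ^ 2 - 4 * ((s + 0) ^ 2 * (t + 0) ^ 2)) ^ 3 ≠ 0 := by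
      simpa using kernelTwo_denominator_ne_zero h
    have : ContinuousAt (fun ε : ℂ => kernelTwo ((s + ε) ^ 2) ((t + ε) ^ 2)) 0 := by
      unfold kernelTwo
      exact ContinuousAt.div (by fun_prop) (by fun_prop) hd
    simpa using this.tendsto.mono_left nhdsWithin_le_nhds
  have hne : ∀ c : ℂ, ∀ᶠ ε in 𝓝[≠] (0 : ℂ), c + ε ≠ 0 := by
    intro c
    by_cases hc : c = 0
    · filter_upwards [self_mem_nhdsWithin] with ε hε
      simpa [hc] using hε
    · have : ∀ᶠ ε in 𝓝 (0 : ℂ), c + ε ≠ 0 :=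
        (by fun_prop : Continuous fun ε : ℂ => c + ε).continuousAt.eventually_ne (by simpa using hc)
      exact nhdsWithin_le_nhds this
  have heq : (fun ε : ℂ => kernelTwo ((s + ε) ^ 2) ((t + ε) ^ 2)) =ᶠ[𝓝[≠] 0]
      fun ε : ℂ => ∑' k : ℕ × ℕ, kernelCoeffTwo k * (((s + ε) ^ 2) ^ k.1 * ((t + ε) ^ 2) ^ k.2) := by
    filter_upwards [hne s, hne t,
      nhdsWithin_le_nhds (Metric.closedBall_mem_nhds (0 : ℂ) hr0)] with ε h1 h2 hε
    have hε' : ‖ε‖ ≤ r := by simpa using hε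
    refine (hasSum_kernelTwo_of_ne_zero ?_ h1 h2).tsum_eq.symm
    have := norm_add_le s ε
    have := norm_add_le t ε
    linarith
  rw [tendsto_nhds_unique (hlim2.congr' heq) hlim]
  exact hsumm.hasSum

theorem exists_sq_eq_of_mem_omegaDomain_two {z w : ℂ × ℂ} (hz : z ∈ OmegaDomain 2)
    (hw : w ∈ OmegaDomain 2) :
    ∃ s t : ℂ, s ^ 2 = z.1 * star w.1 ∧ t ^ 2 = z.2 * star w.2 ∧ ‖s‖ + ‖t‖ < 1 := by
  have hz' : ‖z.1‖ + ‖z.2‖ ^ (2 / 2 : ℝ) < 1 := hz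
  have hw' : ‖w.1‖ + ‖w.2‖ ^ (2 / 2 : ℝ) < 1 := hw
  rw [div_self two_ne_zero, Real.rpow_one] at hz' hw'
  obtain ⟨s, hs⟩ := IsAlgClosed.exists_pow_nat_eq (z.1 * star w.1) zero_lt_two
  obtain ⟨t, ht⟩ := IsAlgClosed.exists_pow_nat_eq (z.2 * star w.2) zero_lt_two
  refine ⟨s, t, hs, ht, ?_⟩
  have hs' : ‖s‖ ^ 2 = ‖z.1‖ * ‖w.1‖ := by rw [← norm_pow, hs, norm_mul, norm_star]
  have ht' : ‖t‖ ^ 2 = ‖z.2‖ * ‖w.2‖ := by rw [← norm_pow, ht, norm_mul, norm_star]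
  -- AM–GM for the cross terms, giving (‖s‖ + ‖t‖)² ≤ (|z₁| + |z₂|)(|w₁| + |w₂|).
  have h1 : 2 * (‖s‖ * ‖t‖) ≤ ‖z.1‖ * ‖w.2‖ + ‖z.2‖ * ‖w.1‖ := by
    refine (pow_le_pow_iff_left₀ (by positivity) (by positivity) two_ne_zero).1 ?_
    have : (2 * (‖s‖ * ‖t‖)) ^ 2 = 4 * (‖z.1‖ * ‖w.2‖) * (‖z.2‖ * ‖w.1‖) := by
      rw [mul_pow, mul_pow, hs', ht']
      ring
    rw [this]
    nlinarith [sq_nonneg (‖z.1‖ * ‖w.2‖ - ‖z.2‖ * ‖w.1‖)]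
  have h2 : (‖s‖ + ‖t‖) ^ 2 < 1 := by
    have h3 : (‖s‖ + ‖t‖) ^ 2 ≤ (‖z.1‖ + ‖z.2‖) * (‖w.1‖ + ‖w.2‖) := by nlinarith
    have := norm_nonneg z.1
    have := norm_nonneg z.2
    have := norm_nonneg w.1
    have := norm_nonneg w.2
    nlinarith
  exact lt_of_pow_lt_pow_left₀ 2 zero_le_one (by simpa using h2)

theorem bergmanKernel_two_eq {z w : ℂ × ℂ} (hz : z ∈ OmegaDomain 2) (hw : w ∈ OmegaDomain 2) :
    2 * Real.pi ^ 2 * bergmanKernel (OmegaDomain 2) z w =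
      kernelTwo (z.1 * star w.1) (z.2 * star w.2) := by
  obtain ⟨s, t, hs, ht, hst⟩ := exists_sq_eq_of_mem_omegaDomain_two hz hw
  have h := hasSum_kernelTwo hst
  rw [hs, ht] at h
  exact (hasSum_bergmanKernel zero_lt_two hz hw).unique h

/-! ### Absence of zeros for p = 2. -/

/-- Applied with T = s² + t², τ = |T|, v = |1 - T|², w = |1 + T|², e = 4|st|². For small τ the bound
e < 1/4 suffices; for large τ, v + w ≥ 5/2 and the cases depend on which of e < v, e < w, e < 1/4 is
efficient. -/
theorem mul_lt_nine_mul_of_bounds {e v w τ : ℝ} (hτ : 0 ≤ τ) (hτ1 : τ < 1) (hvw : v + w = 2 + 2 * τ ^ 2)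
    (hv : (1 - τ) ^ 2 ≤ v) (hw : (1 - τ) ^ 2 ≤ w) (he : 0 ≤ e) (he1 : e < 1 / 4)
    (he2 : e < (1 - τ) ^ 2) : e ^ 2 * (16 + 12 * v - 3 * w) < 9 * v ^ 2 * w := by
  have h0 : 0 < (1 - τ) ^ 2 := by nlinarith
  have hv0 : 0 < v := by linarith
  have hw0 : 0 < w := by linarith
  have hC : 0 < 16 + 12 * v - 3 * w := by nlinarith
  rcases le_total τ (1 / 2) with hτ2 | hτ2
  · have h4 : 1 / 4 ≤ (1 - τ) ^ 2 := by nlinarith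
    have he3 : e ^ 2 < 1 / 16 := by nlinarith
    have h5 : e ^ 2 * (16 + 12 * v - 3 * w) < 1 / 16 * (16 + 12 * v - 3 * w) :=
      mul_lt_mul_of_pos_right he3 hC
    have h6 : 16 + 12 * v - 3 * w ≤ 10 + 15 * v := by nlinarith
    have h7 : 10 + 15 * v ≤ 144 * (v ^ 2 * w) := by
      rcases le_total 1 v with hv1 | hv1
      · have : v ^ 2 * (1 / 4) ≤ v ^ 2 * w := by
          refine mul_le_mul_of_nonneg_left ?_ (by positivity)
          linarith
        nlinarith
      · have : v ^ 2 * (2 - v) ≤ v ^ 2 * w := by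
          refine mul_le_mul_of_nonneg_left ?_ (by positivity)
          nlinarith
        -- This product equals 144v²(2 - v) - 15v - 12, slightly less than the cubic that has to be
        -- nonnegative on [1/4, 1].
        have h8 : 0 ≤ (v - 1 / 4) * (-144 * v ^ 2 + 252 * v + 48) :=
          mul_nonneg (by linarith) (by nlinarith)
        nlinarith
    linarith
  · have hsum : 5 / 2 ≤ v + w := by nlinarith
    rcases le_total (4 / 3) (w - v) with h1 | h1
    · have h2 : 16 + 12 * v - 3 * w ≤ 9 * w := by linarith
      have h3 : e ^ 2 < v ^ 2 := by nlinarith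
      calc e ^ 2 * (16 + 12 * v - 3 * w) ≤ e ^ 2 * (9 * w) := by gcongr
        _ < v ^ 2 * (9 * w) := by gcongr
        _ = 9 * v ^ 2 * w := by ring
    · rcases le_total w v with h2 | h2
      · have h3 : e * (16 + 12 * v - 3 * w) ≤ 4 + 3 * v := by nlinarith
        have h4 : 4 + 3 * v ≤ 9 * v ^ 2 := by nlinarith
        calc e ^ 2 * (16 + 12 * v - 3 * w) = e * (e * (16 + 12 * v - 3 * w)) := by ring
          _ ≤ e * (9 * v ^ 2) := mul_le_mul_of_nonneg_left (h3.trans h4) he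
          _ < w * (9 * v ^ 2) := by gcongr; linarith
          _ = 9 * v ^ 2 * w := by ring
      · have h3 : e ^ 2 < 1 / 16 := by nlinarith
        have h4 : e ^ 2 * (16 + 12 * v - 3 * w) < 1 / 16 * (16 + 12 * v - 3 * w) :=
          mul_lt_mul_of_pos_right h3 hC
        have h5 : 7 / 12 ≤ v := by linarith
        have h6 : v ^ 2 * (5 / 4) ≤ v ^ 2 * w :=
          mul_le_mul_of_nonneg_left (by linarith) (by positivity)
        have h7 : 1 / 16 * (16 + 12 * v - 3 * w) ≤ 45 / 4 * v ^ 2 := by nlinarith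
        linarith

theorem kernelTwo_ne_zero {s t : ℂ} (h : ‖s‖ + ‖t‖ < 1) : kernelTwo (s ^ 2) (t ^ 2) ≠ 0 := by
  refine div_ne_zero (mul_ne_zero (by norm_num) fun h0 => ?_)
    (pow_ne_zero 3 (kernelTwo_denominator_ne_zero h))
  set T : ℂ := s ^ 2 + t ^ 2 with hT
  have h1 : 3 * (1 - T) ^ 2 * (1 + T) = -(4 * (s ^ 2 * t ^ 2) * (5 - 3 * T)) := by
    rw [hT]
    linear_combination h0
  have hs := norm_nonneg s
  have ht := norm_nonneg t
  have hTn : ‖T‖ ≤ ‖s‖ ^ 2 + ‖t‖ ^ 2 := by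
    rw [← norm_pow, ← norm_pow]
    exact norm_add_le _ _
  set e : ℝ := (2 * (‖s‖ * ‖t‖)) ^ 2 with he
  have hq1 : 2 * (‖s‖ * ‖t‖) < 1 / 2 := by nlinarith [sq_nonneg (‖s‖ - ‖t‖)]
  -- From (‖s‖ + ‖t‖)² < 1 and |T| ≤ ‖s‖² + ‖t‖².
  have hq2 : 2 * (‖s‖ * ‖t‖) < 1 - ‖T‖ := by nlinarith
  have hq0 : 0 ≤ 2 * (‖s‖ * ‖t‖) := by positivity
  have h2 : 3 * ‖1 - T‖ ^ 2 * ‖1 + T‖ = e * ‖5 - 3 * T‖ := by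
    have := congrArg norm h1
    rw [norm_neg, norm_mul, norm_mul, norm_mul, norm_mul, norm_mul, norm_pow, norm_pow,
      norm_pow, Complex.norm_ofNat, Complex.norm_ofNat] at this
    rw [this, he]
    ring
  have n1 : ‖1 - T‖ ^ 2 = 1 + ‖T‖ ^ 2 - 2 * T.re := by
    rw [← Complex.normSq_eq_norm_sq, ← Complex.normSq_eq_norm_sq]
    simp [Complex.normSq_apply]
    ring
  have n2 : ‖1 + T‖ ^ 2 = 1 + ‖T‖ ^ 2 + 2 * T.re := by
    rw [← Complex.normSq_eq_norm_sq, ← Complex.normSq_eq_norm_sq]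
    simp [Complex.normSq_apply]
    ring
  have n3 : ‖5 - 3 * T‖ ^ 2 = 16 + 12 * ‖1 - T‖ ^ 2 - 3 * ‖1 + T‖ ^ 2 := by
    rw [n1, n2, ← Complex.normSq_eq_norm_sq, ← Complex.normSq_eq_norm_sq]
    simp [Complex.normSq_apply]
    ring
  have hre := abs_le.1 (Complex.abs_re_le_norm T)
  have key := mul_lt_nine_mul_of_bounds (e := e) (v := ‖1 - T‖ ^ 2) (w := ‖1 + T‖ ^ 2)
    (norm_nonneg T) (by linarith) (by rw [n1, n2]; ring) (by rw [n1]; nlinarith)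
    (by rw [n2]; nlinarith) (by positivity) (by rw [he]; nlinarith) (by rw [he]; gcongr)
  rw [← n3, ← mul_pow, ← h2] at key
  exact key.ne (by ring)

/-! ### Boundary values for p = 2. -/

theorem fst_one_mem_frontier_omegaDomain {p : ℝ} (hp : 0 < p) {u : ℂ} (hu : ‖u‖ = 1) :
    (u, 0) ∈ frontier (OmegaDomain p) := by
  rw [(isCompleteReinhardt_omegaDomain hp).isOpen.frontier_eq]
  refine ⟨?_, fun h => by simpa [hu] using (mem_omegaDomain_fst hp).1 h⟩
  have h1 : (1 : ℝ) ∈ closure (Set.Ioo (0 : ℝ) 1) := by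
    rw [closure_Ioo zero_ne_one]
    simp
  have h2 := map_mem_closure (f := fun r : ℝ => ((r : ℂ) * u, (0 : ℂ))) (t := OmegaDomain p)
    (by fun_prop) h1 fun r hr => (mem_omegaDomain_fst hp).2 (by
      rw [norm_mul, hu, mul_one, Complex.norm_real, Real.norm_of_nonneg hr.1.le]
      exact hr.2)
  simpa using h2

/-- At ν = -1, μ = 0 the denominator of `kernelTwo` is 4³, while the factor 1 + ν + μ and the
product νμ both vanish. -/
theorem tendsto_bergmanKernel_two :
    Tendsto (fun q : (ℂ × ℂ) × (ℂ × ℂ) => bergmanKernel (OmegaDomain 2) q.1 q.2)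
      (𝓝[OmegaDomain 2 ×ˢ OmegaDomain 2] ((1, 0), (-1, 0))) (𝓝 0) := by
  have hpic : (2 * Real.pi ^ 2 : ℂ) ≠ 0 := by simp [Real.pi_ne_zero]
  let g : (ℂ × ℂ) × (ℂ × ℂ) → ℂ := fun q =>
    kernelTwo (q.1.1 * star q.2.1) (q.1.2 * star q.2.2) / (2 * Real.pi ^ 2)
  have hg : ContinuousAt g ((1, 0), (-1, 0)) := by
    simp only [g]
    unfold kernelTwo
    refine ContinuousAt.div_const (ContinuousAt.div (by fun_prop) (by fun_prop) ?_) _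
    norm_num
  have hg0 : g ((1, 0), (-1, 0)) = 0 := by simp [g, kernelTwo]
  have h1 := hg.tendsto.mono_left
    (nhdsWithin_le_nhds (s := OmegaDomain 2 ×ˢ OmegaDomain 2))
  rw [hg0] at h1
  refine h1.congr' ?_
  filter_upwards [self_mem_nhdsWithin] with q hq
  rw [div_eq_iff hpic, ← bergmanKernel_two_eq hq.1 hq.2]
  ring

theorem mainTheorem5 :
    -- the Bergman kernel of each domain exists
    (∀ p : ℝ, 0 < p → IsBergmanKernel (OmegaDomain p) (bergmanKernel (OmegaDomain p))) ∧
    -- on the slice where the second coordinates vanish there is a zero exactly when `p > 2`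
    (∀ p : ℝ, 0 < p →
      ((∃ z₁ w₁ : ℂ, (z₁, 0) ∈ OmegaDomain p ∧ (w₁, 0) ∈ OmegaDomain p ∧
        bergmanKernel (OmegaDomain p) (z₁, 0) (w₁, 0) = 0) ↔ 2 < p)) ∧
    -- for `p > 2` there is also a zero where the first coordinates vanish
    (∀ p : ℝ, 2 < p →
      ∃ z₂ w₂ : ℂ, (0, z₂) ∈ OmegaDomain p ∧ (0, w₂) ∈ OmegaDomain p ∧
        bergmanKernel (OmegaDomain p) (0, z₂) (0, w₂) = 0) ∧
    -- for `p = 2` there is no zero in the interior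
    (∀ z ∈ OmegaDomain 2, ∀ w ∈ OmegaDomain 2, bergmanKernel (OmegaDomain 2) z w ≠ 0) ∧
    -- the boundary value of the kernel for `p = 2` at the pair `(1, 0)`, `(-1, 0)` is zero
    ((1, 0) ∈ frontier (OmegaDomain 2) ∧ (-1, 0) ∈ frontier (OmegaDomain 2) ∧
      Tendsto (fun q : (ℂ × ℂ) × (ℂ × ℂ) => bergmanKernel (OmegaDomain 2) q.1 q.2)
        (𝓝[OmegaDomain 2 ×ˢ OmegaDomain 2] ((1, 0), (-1, 0))) (𝓝 0)) := by
  refine ⟨fun p hp => isBergmanKernel_bergmanKernel (isCompleteReinhardt_omegaDomain hp),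
    fun p hp => exists_bergmanKernel_fst_eq_zero_iff hp,
    fun p hp => exists_bergmanKernel_snd_eq_zero hp, fun z hz w hw h => ?_,
    fst_one_mem_frontier_omegaDomain zero_lt_two norm_one,
    fst_one_mem_frontier_omegaDomain zero_lt_two (by rw [norm_neg, norm_one]),
    tendsto_bergmanKernel_two⟩
  obtain ⟨s, t, hs, ht, hst⟩ := exists_sq_eq_of_mem_omegaDomain_two hz hw
  have h1 := bergmanKernel_two_eq hz hw
  rw [h, mul_zero, ← hs, ← ht] at h1
  exact kernelTwo_ne_zero hst h1.symm
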